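/- Let $G$ be a compact, connected matrix Lie group, $G \subset GL(n,\mathbb C)$, with Lie algebra $\mathfrak g$. On $\mathbb R^{1+3}$, with Cartesian coordinates $(t,x)=(x^0,x^1,x^2,x^3)$ and the Minkowski metric of signature $(-+++)$, let $$\mathbb D=\{(t,x)\in\mathbb R^{1+3} : |x|\le t+1,\ |x|\le 1-t\},\qquad \partial^-\mathbb D=\{(t,x)\in\mathbb D : |x|=t+1\},\qquad p=(-1,0).$$ For a smooth $\mathfrak g$-valued 1-form $A\in\Omega^1(\mathbb D;\mathfrak g)$ (smooth up to the boundary) let $d_A\omega=d\omega+[A,\omega]$, where $[A,\omega]=A\wedge\omega-(-1)^k\omega\wedge A$ for a $k$-form $\omega$, let $F_A=dA+\tfrac12[A,A]$ be the curvature and let $d_A^*=\star d_A\star$, where $\star$ is the Hodge star of the Minkowski metric. Let $G^0(\mathbb D,p)=\{\mathbf U\in C^\infty(\mathbb D;G):\mathbf U(p)=\mathrm{id}\}$. Write $A\sim B$ in $\mathbb D$ if there is $\mathbf U\in G^0(\mathbb D,p)$ such that $$B=\mathbf U^{-1}d\mathbf U+\mathbf U^{-1}A\,\mathbf U \qquad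 (*)$$ holds in $\mathbb D$, and write $A\sim B$ near $\partial^-\mathbb D$ if there are $\mathbf U\in G^0(\mathbb D,p)$ and a neighbourhood $\mathcal U$ of $\partial^-\mathbb D$ such that $(*)$ holds in $\mathcal U\cap\mathbb D$. Suppose that $A,B\in\Omega^1(\mathbb D;\mathfrak g)$ solve the Yang--Mills equations $d_A^*F_A=0$ and $d_B^*F_B=0$ in $\mathbb D$, and that $A\sim B$ near $\partial^-\mathbb D$. Then $A\sim B$ in $\mathbb D$. -/

import Mathlib

open scoped ContDiff Matrix.Norms.L2Operator

namespace YangMills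

open Set

noncomputable section

/-! ### Minkowski space and the causal diamond -/

/-- Space-time `ℝ^{1+3}`; a point is `(t, x)` and `‖x‖` is the Euclidean norm of `x ∈ ℝ³`. -/
abbrev Spacetime : Type := ℝ × EuclideanSpace ℝ (Fin 3)

/-- The closed causal diamond `{(t, x) : |x| ≤ t + 1, |x| ≤ 1 - t}`. -/
def diamond : Set Spacetime := {z | ‖z.2‖ ≤ z.1 + 1 ∧ ‖z.2‖ ≤ 1 - z.1}

/-- The lower boundary `{(t, x) ∈ 𝔻 : |x| = t + 1}`. -/
def lowerBoundary : Set Spacetime := {z | z ∈ diamond ∧ ‖z.2‖ = z.1 + 1}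

/-- The bottom tip `p = (-1, 0)` of the diamond. -/
def basePoint : Spacetime := (-1, 0)

/-- The Cartesian coordinates `(x⁰, x¹, x², x³) = (t, x)`. -/
def coords (z : Spacetime) : Fin 4 → ℝ := Fin.cons z.1 (fun j => z.2 j)

/-- The coordinate vectors `∂_0, ∂_1, ∂_2, ∂_3`. -/
def coordVec : Fin 4 → Spacetime := Fin.cons (1, 0) (fun j => (0, EuclideanSpace.single j 1))

/-- The diagonal entries `g^{αα}` of the Minkowski metric, of signature `(- + + +)`. -/
def metricDiag : Fin 4 → ℝ := Fin.cons (-1) (fun _ => 1)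

/-- The volume form `dx⁰ ∧ dx¹ ∧ dx² ∧ dx³`. -/
def vol (w : Fin 4 → Spacetime) : ℝ := Matrix.det (Matrix.of fun a b => coords (w a) b)

/-! ### Smoothness on the closed diamond -/

/-- `f` is smooth on the set `s`: it is the restriction to `s` of a smooth map defined on an open
neighbourhood of `s`. -/
def SmoothOn {F : Type*} [NormedAddCommGroup F] [NormedSpace ℝ F]
    (s : Set Spacetime) (f : Spacetime → F) : Prop :=
  ∃ (O : Set Spacetime) (g : Spacetime → F),
    IsOpen O ∧ s ⊆ O ∧ ContDiffOn ℝ ∞ g O ∧ EqOn f g s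

/-! ### The Hodge star -/

section HodgeStar

variable {F : Type*} [NormedAddCommGroup F] [NormedSpace ℝ F]

theorem coords_add (z w : Spacetime) : coords (z + w) = coords z + coords w := by
  ext a
  refine Fin.cases ?_ (fun j => ?_) a <;> simp [coords]

theorem coords_smul (c : ℝ) (z : Spacetime) : coords (c • z) = c • coords z := by
  ext a
  refine Fin.cases ?_ (fun j => ?_) a <;> simp [coords]

theorem continuous_coords : Continuous coords := by
  refine continuous_pi fun a => ?_
  refine Fin.cases ?_ (fun j => ?_) a
  · simpa [coords] using continuous_fst
  · simp only [coords, Fin.cons_succ]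
    fun_prop

/-- The `k + m` vectors `u_1, …, u_k, v_1, …, v_m`, with `k + m = 4`, as a family over `Fin 4`. -/
def joinVec {k m : ℕ} (h : k + m = 4) (u : Fin k → Spacetime) (v : Fin m → Spacetime) :
    Fin 4 → Spacetime :=
  fun a => Sum.elim u v ((finSumFinEquiv.trans (finCongr h)).symm a)

theorem joinVec_update {k m : ℕ} (h : k + m = 4) (u : Fin k → Spacetime) [DecidableEq (Fin m)]
    (v : Fin m → Spacetime) (i : Fin m) (x : Spacetime) :
    joinVec h u (Function.update v i x) =
      Function.update (joinVec h u v) (finSumFinEquiv.trans (finCongr h) (Sum.inr i)) x := by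
  ext1 a
  obtain ⟨b, rfl⟩ := (finSumFinEquiv.trans (finCongr h)).surjective a
  simp only [joinVec, Equiv.symm_apply_apply, Function.update_apply,
    (finSumFinEquiv.trans (finCongr h)).injective.eq_iff]
  rcases b with b | b <;> simp [Function.update_apply]

theorem vol_update (w : Fin 4 → Spacetime) (a : Fin 4) (x : Spacetime) :
    vol (Function.update w a x) =
      (Matrix.updateRow (Matrix.of fun a b => coords (w a) b) a (coords x)).det := by
  unfold vol
  congr 1
  ext b c
  by_cases hb : b = a
  · subst hb; simp
  · simp [hb]

/-- The contraction `vol(u_1, …, u_k, ·, …, ·)` of the volume form, an `m`-form. -/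
def volContract {k m : ℕ} (h : k + m = 4) (u : Fin k → Spacetime) :
    Spacetime [⋀^Fin m]→L[ℝ] ℝ where
  toFun v := vol (joinVec h u v)
  map_update_add' v i x y := by
    simp only [joinVec_update, vol_update, coords_add, Matrix.det_updateRow_add]
  map_update_smul' v i c x := by
    simp only [joinVec_update, vol_update, coords_smul, Matrix.det_updateRow_smul, smul_eq_mul]
  map_eq_zero_of_eq' v i j hv hij := by
    refine Matrix.det_zero_of_row_eq (i := finSumFinEquiv.trans (finCongr h) (Sum.inr i))
      (j := finSumFinEquiv.trans (finCongr h) (Sum.inr j)) (by simpa using hij) ?_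
    ext b
    simp only [Matrix.of_apply, joinVec, Equiv.symm_apply_apply, Sum.elim_inr, hv]
  cont := by
    refine Continuous.matrix_det (continuous_matrix fun a b => ?_)
    refine (continuous_apply b).comp (continuous_coords.comp ?_)
    change Continuous fun v : Fin m → Spacetime =>
      Sum.elim u v ((finSumFinEquiv.trans (finCongr h)).symm a)
    rcases (finSumFinEquiv.trans (finCongr h)).symm a with c | c
    · exact continuous_const
    · exact continuous_apply c

/-- The Hodge star of a `k`-form, with `k + m = 4`:
`⋆η = (1/k!) ∑ g^{i₁i₁} ⋯ g^{i_k i_k} η(∂_{i₁}, …, ∂_{i_k}) vol(∂_{i₁}, …, ∂_{i_k}, ·)`. It is the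
linear map with `ξ ∧ ⋆η = ⟨ξ, η⟩ vol`. -/
def hodgeStar {k m : ℕ} (h : k + m = 4) (η : Spacetime [⋀^Fin k]→L[ℝ] F) :
    Spacetime [⋀^Fin m]→L[ℝ] F :=
  ((k.factorial : ℝ)⁻¹) • ∑ i : Fin k → Fin 4, (∏ a, metricDiag (i a)) •
    (ContinuousLinearMap.toSpanSingleton ℝ (η fun a => coordVec (i a))).compContinuousAlternatingMap
      (volContract h fun a => coordVec (i a))

end HodgeStar

/-! ### Matrix-valued forms, covariant derivative and the Yang–Mills equations -/

section Forms

variable {n : ℕ}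

/-- Complex `n × n` matrices. -/
abbrev Mat (n : ℕ) : Type := Matrix (Fin n) (Fin n) ℂ

/-- The commutator `X ↦ (Y ↦ X Y - Y X)`. -/
def matComm (n : ℕ) : Mat n →L[ℝ] Mat n →L[ℝ] Mat n :=
  ContinuousLinearMap.mul ℝ (Mat n) - (ContinuousLinearMap.mul ℝ (Mat n)).flip

/-- The pairing `[a, η] = a ∧ η - (-1)^k η ∧ a` of a 1-form with a `k`-form at a point, that is,
`[a, η](v_0, …, v_k) = ∑ (-1)^i [a(v_i), η(v_0, …, v_{i-1}, v_{i+1}, …, v_k)]`. -/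
def formBracket {k : ℕ} (a : Spacetime →L[ℝ] Mat n) (η : Spacetime [⋀^Fin k]→L[ℝ] Mat n) :
    Spacetime [⋀^Fin (k + 1)]→L[ℝ] Mat n :=
  ContinuousAlternatingMap.alternatizeUncurryFin <| LinearMap.toContinuousLinearMap
    { toFun := fun v => (matComm n (a v)).compContinuousAlternatingMap η
      map_add' := fun v w => by ext; simp
      map_smul' := fun c v => by ext; simp }

/-- A linear map viewed as an alternating map of one variable. -/
def asForm (a : Spacetime →L[ℝ] Mat n) : Spacetime [⋀^Fin 1]→L[ℝ] Mat n :=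
  ContinuousAlternatingMap.ofSubsingleton ℝ Spacetime (Mat n) 0 a

/-- The covariant derivative `d_A η = dη + [A, η]` on the set `s`. -/
def covDeriv {k : ℕ} (s : Set Spacetime) (A : Spacetime → Spacetime →L[ℝ] Mat n)
    (η : Spacetime → Spacetime [⋀^Fin k]→L[ℝ] Mat n) (z : Spacetime) :
    Spacetime [⋀^Fin (k + 1)]→L[ℝ] Mat n :=
  extDerivWithin η s z + formBracket (A z) (η z)

/-- The curvature `F_A = dA + ½ [A, A]` on the set `s`. -/
def curvature (s : Set Spacetime) (A : Spacetime → Spacetime →L[ℝ] Mat n) (z : Spacetime) :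
    Spacetime [⋀^Fin 2]→L[ℝ] Mat n :=
  extDerivWithin (fun y => asForm (A y)) s z + (2⁻¹ : ℝ) • formBracket (A z) (asForm (A z))

/-- The formal adjoint `d_A^* = ⋆ d_A ⋆` acting on 2-forms on the set `s`. -/
def covCoderiv (s : Set Spacetime) (A : Spacetime → Spacetime →L[ℝ] Mat n)
    (η : Spacetime → Spacetime [⋀^Fin 2]→L[ℝ] Mat n) (z : Spacetime) :
    Spacetime [⋀^Fin 1]→L[ℝ] Mat n :=
  hodgeStar (k := 3) (m := 1) rfl
    (covDeriv s A (fun y => hodgeStar (k := 2) (m := 2) rfl (η y)) z)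

/-- `A` solves the Yang–Mills equations `d_A^* F_A = 0` in the diamond. -/
def SolvesYangMills (A : Spacetime → Spacetime →L[ℝ] Mat n) : Prop :=
  ∀ z ∈ diamond, covCoderiv diamond A (curvature diamond A) z = 0

end Forms

/-! ### Connections and gauge equivalence -/

section Gauge

variable {n : ℕ}

/-- The Lie algebra of a closed matrix group `G`: the matrices `X` with `exp (t X) ∈ G` for all
real `t`. -/
def lieAlg (G : Subgroup (Matrix.GeneralLinearGroup (Fin n) ℂ)) : Set (Mat n) :=
  {X | ∀ t : ℝ, ∃ g ∈ G, (g : Mat n) = NormedSpace.exp (t • X)}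

/-- `A ∈ Ω¹(𝔻; 𝔤)`: a smooth 1-form on the diamond with values in the Lie algebra of `G`. -/
def IsConnection (G : Subgroup (Matrix.GeneralLinearGroup (Fin n) ℂ)) (A : Spacetime → Spacetime →L[ℝ] Mat n) : Prop :=
  SmoothOn diamond A ∧ ∀ z ∈ diamond, ∀ v, A z v ∈ lieAlg G

/-- `U ∈ G⁰(𝔻, p)`: a smooth map from the diamond to `G` with `U(p) = id`. -/
def IsPointedGauge (G : Subgroup (Matrix.GeneralLinearGroup (Fin n) ℂ)) (U : Spacetime → Matrix.GeneralLinearGroup (Fin n) ℂ) : Prop :=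
  SmoothOn diamond (fun z => (U z : Mat n)) ∧ (∀ z ∈ diamond, U z ∈ G) ∧ U basePoint = 1

/-- `B = U⁻¹ dU + U⁻¹ A U` at the point `z` of the diamond. -/
def GaugeRelatedAt (U : Spacetime → Matrix.GeneralLinearGroup (Fin n) ℂ) (A B : Spacetime → Spacetime →L[ℝ] Mat n)
    (z : Spacetime) : Prop :=
  ∀ v, B z v =
    ((U z)⁻¹ : Matrix.GeneralLinearGroup (Fin n) ℂ) * fderivWithin ℝ (fun y => (U y : Mat n)) diamond z v
      + ((U z)⁻¹ : Matrix.GeneralLinearGroup (Fin n) ℂ) * A z v * (U z : Mat n)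

/-- `A ∼ B` in the diamond. -/
def GaugeEquiv (G : Subgroup (Matrix.GeneralLinearGroup (Fin n) ℂ)) (A B : Spacetime → Spacetime →L[ℝ] Mat n) : Prop :=
  ∃ U, IsPointedGauge G U ∧ ∀ z ∈ diamond, GaugeRelatedAt U A B z

/-- `A ∼ B` near the lower boundary of the diamond. -/
def GaugeEquivNearLower (G : Subgroup (Matrix.GeneralLinearGroup (Fin n) ℂ))
    (A B : Spacetime → Spacetime →L[ℝ] Mat n) : Prop :=
  ∃ U, IsPointedGauge G U ∧ ∃ N : Set Spacetime, IsOpen N ∧ lowerBoundary ⊆ N ∧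
    ∀ z ∈ N ∩ diamond, GaugeRelatedAt U A B z

end Gauge

end

end YangMills

/-!
Extend `A`, `B` and the given gauge transformation smoothly to space-time, and solve the linear
transport equation `∂_0 U + A_0 U - U B_0 = 0` for a smooth `U` that agrees with the given gauge
transformation near the lower boundary; since `A_0` and `B_0` are `𝔤`-valued, `U` stays in `G`. It
remains to see that the covariant derivative `D_μ U = ∂_μ U + A_μ U - U B_μ` vanishes. As
`D_0 U = 0`, the fields `a_i = D_i U`, `e_j = f_{0j}` and `f_{ij}`, where
`f_{μν} = F^A_{μν} U - U F^B_{μν}` is the commutator of the covariant derivatives on `U`, satisfy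
`D_0 a_i = e_i`, the Yang–Mills equations `D_0 e_j = ∑ D_i f_{ij}` and the Bianchi identity
`D_0 f_{ij} = D_i e_j - D_j e_i` up to terms linear in `(a, e, f)`. This is a Maxwell-type symmetric
hyperbolic system whose energy flux is causal, and its solution vanishes near the lower boundary, so
an energy estimate gives `(a, e, f) = 0` in the open diamond and, by continuity, `D U = 0` in the
closed one.
-/

namespace YangMills

open Set
open scoped Interval

universe u

/-! ### Linear ordinary differential equations depending on a parameter -/

section LinearODE

variable {Z F : Type*} [NormedAddCommGroup F] [NormedSpace ℝ F]

theorem linearODE_unique {L : ℝ → F →L[ℝ] F} (hL : Continuous L) {f g : ℝ → F}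
    (hf : ∀ s, HasDerivAt f (L s (f s)) s) (hg : ∀ s, HasDerivAt g (L s (g s)) s) {t₀ : ℝ}
    (h₀ : f t₀ = g t₀) : f = g := by
  ext s
  obtain ⟨M, hM⟩ := (isCompact_Icc (a := min t₀ s - 1)
    (b := max t₀ s + 1)).exists_bound_of_continuousOn hL.continuousOn
  have hlip : ∀ t ∈ Ioo (min t₀ s - 1) (max t₀ s + 1), LipschitzOnWith (Real.nnabs M) (L t) univ :=
    fun t ht => (ContinuousLinearMap.lipschitzWith_of_opNorm_le
      (show ‖L t‖ ≤ Real.nnabs M from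
        (hM t (Ioo_subset_Icc_self ht)).trans (le_abs_self M))).lipschitzOnWith
  refine ODE_solution_unique_of_mem_Ioo hlip (t₀ := t₀) ⟨?_, ?_⟩
    (fun t _ => ⟨hf t, mem_univ _⟩) (fun t _ => ⟨hg t, mem_univ _⟩) h₀ ⟨?_, ?_⟩ <;>
  linarith [min_le_left t₀ s, min_le_right t₀ s, le_max_left t₀ s, le_max_right t₀ s]

/-- The terms of the Picard series of the linear equation `∂_s Y = L(s, z) Y`, `Y(0, z) = y₀`. -/
noncomputable def picardTerm (L : ℝ × Z → F →L[ℝ] F) (y₀ : F) : ℕ → ℝ → Z → F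
  | 0 => fun _ _ => y₀
  | k + 1 => fun s z => ∫ r in (0 : ℝ)..s, L (r, z) (picardTerm L y₀ k r z)

theorem abs_le_of_mem_uIoc_zero {r s : ℝ} (hr : r ∈ Ι 0 s) : |r| ≤ |s| := by
  simpa using abs_sub_left_of_mem_uIcc (uIoc_subset_uIcc hr)

theorem norm_picardTerm_le {L : ℝ × Z → F →L[ℝ] F} (y₀ : F) {M R : ℝ} (hM : 0 ≤ M) {z : Z}
    (hLM : ∀ s, |s| ≤ R → ‖L (s, z)‖ ≤ M) (k : ℕ) {s : ℝ} (hs : |s| ≤ R) :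
    ‖picardTerm L y₀ k s z‖ ≤ ‖y₀‖ * (M ^ k / k.factorial) * |s| ^ k := by
  induction k generalizing s with
  | zero => simp [picardTerm]
  | succ k ih =>
    have hbound : ∀ r ∈ Ι 0 s, ‖L (r, z) (picardTerm L y₀ k r z)‖
        ≤ M * (‖y₀‖ * (M ^ k / k.factorial)) * |r - 0| ^ k := by
      intro r hr
      have hrR : |r| ≤ R := (abs_le_of_mem_uIoc_zero hr).trans hs
      calc ‖L (r, z) (picardTerm L y₀ k r z)‖ ≤ ‖L (r, z)‖ * ‖picardTerm L y₀ k r z‖ :=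
            (L (r, z)).le_opNorm _
        _ ≤ M * (‖y₀‖ * (M ^ k / k.factorial) * |r| ^ k) := by
            gcongr
            · exact hLM r hrR
            · exact ih hrR
        _ = M * (‖y₀‖ * (M ^ k / k.factorial)) * |r - 0| ^ k := by rw [sub_zero]; ring
    calc ‖picardTerm L y₀ (k + 1) s z‖
        = ‖∫ r in Ι 0 s, L (r, z) (picardTerm L y₀ k r z)‖ :=
          intervalIntegral.norm_intervalIntegral_eq _ _ _ _
      _ ≤ ∫ r in Ι 0 s, M * (‖y₀‖ * (M ^ k / k.factorial)) * |r - 0| ^ k :=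
          MeasureTheory.norm_integral_le_of_norm_le
            (Continuous.integrableOn_uIoc (by fun_prop))
            ((MeasureTheory.ae_restrict_iff' measurableSet_uIoc).2 (.of_forall hbound))
      _ = ‖y₀‖ * (M ^ (k + 1) / (k + 1).factorial) * |s| ^ (k + 1) := by
          rw [MeasureTheory.integral_const_mul, integral_pow_abs_sub_uIoc, sub_zero,
            Nat.factorial_succ]
          push_cast
          field_simp
          ring

variable [TopologicalSpace Z]

theorem exists_summable_norm_picardTerm_le {L : ℝ × Z → F →L[ℝ] F} (hL : Continuous L) (y₀ : F)
    (R : ℝ) {K : Set Z} (hK : IsCompact K) :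
    ∃ u : ℕ → ℝ, Summable u ∧
      ∀ k s, |s| ≤ R → ∀ z ∈ K, ‖picardTerm L y₀ k s z‖ ≤ u k := by
  obtain ⟨M, hM⟩ := (isCompact_Icc (a := -R) (b := R)).prod hK |>.exists_bound_of_continuousOn
    hL.continuousOn
  refine ⟨fun k => ‖y₀‖ * ((|M| * R) ^ k / k.factorial),
    (Real.summable_pow_div_factorial (|M| * R)).mul_left _, fun k s hs z hz => ?_⟩
  have hLM : ∀ r, |r| ≤ R → ‖L (r, z)‖ ≤ |M| := fun r hr =>
    (hM (r, z) ⟨abs_le.1 hr, hz⟩).trans (le_abs_self M)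
  calc ‖picardTerm L y₀ k s z‖ ≤ ‖y₀‖ * (|M| ^ k / k.factorial) * |s| ^ k :=
        norm_picardTerm_le y₀ (abs_nonneg M) hLM k hs
    _ ≤ ‖y₀‖ * (|M| ^ k / k.factorial) * R ^ k := by gcongr
    _ = ‖y₀‖ * ((|M| * R) ^ k / k.factorial) := by rw [mul_pow]; ring

theorem continuous_picardTerm {L : ℝ × Z → F →L[ℝ] F} (hL : Continuous L) (y₀ : F) (k : ℕ) :
    Continuous fun p : ℝ × Z => picardTerm L y₀ k p.1 p.2 := by
  induction k with
  | zero => exact continuous_const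
  | succ k ih =>
    have hswap : Continuous fun q : (ℝ × Z) × ℝ => (q.2, q.1.2) := by fun_prop
    exact intervalIntegral.continuous_parametric_intervalIntegral_of_continuous
      (f := fun (p : ℝ × Z) r => L (r, p.2) (picardTerm L y₀ k r p.2))
      ((hL.comp hswap).clm_apply (ih.comp hswap)) continuous_fst

variable [CompleteSpace F]

theorem continuous_tsum_picardTerm [WeaklyLocallyCompactSpace Z] {L : ℝ × Z → F →L[ℝ] F}
    (hL : Continuous L) (y₀ : F) :
    Continuous fun p : ℝ × Z => ∑' k, picardTerm L y₀ k p.1 p.2 := by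
  refine continuous_iff_continuousAt.2 fun p => ?_
  obtain ⟨K, hK, hpK⟩ := exists_compact_mem_nhds p.2
  obtain ⟨u, hu, hle⟩ := exists_summable_norm_picardTerm_le hL y₀ (|p.1| + 1) hK
  refine (continuousOn_tsum (s := Icc (-(|p.1| + 1)) (|p.1| + 1) ×ˢ K)
    (fun k => (continuous_picardTerm hL y₀ k).continuousOn) hu
    (fun k q hq => hle k q.1 (abs_le.2 hq.1) q.2 hq.2)).continuousAt ?_
  refine prod_mem_nhds (Icc_mem_nhds ?_ ?_) hpK
  · linarith [neg_abs_le p.1]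
  · linarith [le_abs_self p.1]

theorem tsum_picardTerm_eq_add_integral {L : ℝ × Z → F →L[ℝ] F} (hL : Continuous L) (y₀ : F)
    (s : ℝ) (z : Z) : (∑' k, picardTerm L y₀ k s z)
      = y₀ + ∫ r in (0 : ℝ)..s, L (r, z) (∑' k, picardTerm L y₀ k r z) := by
  obtain ⟨u, hu, hle⟩ :=
    exists_summable_norm_picardTerm_le hL y₀ |s| (isCompact_singleton (x := z))
  have hslice : Continuous fun r : ℝ => (r, z) := by fun_prop
  obtain ⟨M, hM⟩ := (isCompact_uIcc (a := 0) (b := s)).exists_bound_of_continuousOn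
    (hL.comp hslice).continuousOn
  have hsum : ∀ r, |r| ≤ |s| → Summable fun k => picardTerm L y₀ k r z := fun r hr =>
    Summable.of_norm_bounded hu fun k => hle k r hr z rfl
  rw [(hsum s le_rfl).tsum_eq_zero_add]
  congr 1
  refine HasSum.tsum_eq <| intervalIntegral.hasSum_integral_of_dominated_convergence
    (fun k _ => M * u k) (fun k => ?_) (fun k => .of_forall fun r hr => ?_)
    (.of_forall fun _ _ => hu.mul_left M) (by simp) (.of_forall fun r hr => ?_)
  · exact ((hL.comp hslice).clm_apply
      ((continuous_picardTerm hL y₀ k).comp hslice)).aestronglyMeasurable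
  · exact (L (r, z)).le_of_opNorm_le_of_le (hM r (uIoc_subset_uIcc hr))
      (hle k r (abs_le_of_mem_uIoc_zero hr) z rfl)
  · exact (hsum r (abs_le_of_mem_uIoc_zero hr)).hasSum.mapL (L (r, z))

theorem exists_continuous_linearODE_solution [WeaklyLocallyCompactSpace Z]
    {L : ℝ × Z → F →L[ℝ] F} (hL : Continuous L) (y₀ : F) :
    ∃ Y : ℝ → Z → F, Continuous (fun p : ℝ × Z => Y p.1 p.2) ∧ (∀ z, Y 0 z = y₀) ∧
      ∀ s z, HasDerivAt (fun r => Y r z) (L (s, z) (Y s z)) s := by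
  have hY := continuous_tsum_picardTerm hL y₀
  refine ⟨fun s z => ∑' k, picardTerm L y₀ k s z, hY, fun z => ?_, fun s z => ?_⟩
  · simp [tsum_picardTerm_eq_add_integral hL y₀ 0 z]
  · have hslice : Continuous fun r : ℝ => (r, z) := by fun_prop
    have hint := (((hL.comp hslice).clm_apply
      (hY.comp hslice)).integral_hasStrictDerivAt 0 s).hasDerivAt.const_add y₀
    exact hint.congr_of_eventuallyEq
      (.of_forall fun r => tsum_picardTerm_eq_add_integral hL y₀ r z)

end LinearODE

section ParameterDerivative

variable {Z F : Type u} [NormedAddCommGroup Z] [NormedSpace ℝ Z] [NormedAddCommGroup F]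
  [NormedSpace ℝ F]

theorem hasFDerivAt_of_sub_eq_apply {f : Z → F} {z : Z} {q : Z → Z →L[ℝ] F}
    (hq : ContinuousAt q z) (hf : ∀ y, f y - f z = q y (y - z)) : HasFDerivAt f (q z) z := by
  have hsmall : (fun y => q y - q z) =o[nhds z] (fun _ => (1 : ℝ)) :=
    (Asymptotics.isLittleO_one_iff ℝ).2 (by simpa using hq.tendsto.sub_const (q z))
  refine HasFDerivAt.of_isLittleO ?_
  simp only [hf, ← sub_apply]
  refine (Asymptotics.IsBigO.of_bound 1 (.of_forall fun y => ?_) : _ =O[nhds z]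
    fun y => ‖q y - q z‖ * ‖y - z‖).trans_isLittleO ?_
  · simpa using (q y - q z).le_opNorm (y - z)
  · simpa using hsmall.norm_left.mul_isBigO (Asymptotics.isBigO_refl (fun y => ‖y - z‖) (nhds z))

/-- The mean over the segment from `z` to `y` of the derivative of `L` in the parameter. -/
noncomputable def meanParamDeriv (L : ℝ × Z → F) (s : ℝ) (z y : Z) : Z →L[ℝ] F :=
  ∫ r in (0 : ℝ)..1, fderiv ℝ (fun x => L (s, x)) (z + r • (y - z))

theorem contDiff_fderiv_param {n : ℕ∞} {L : ℝ × Z → F} (hL : ContDiff ℝ (n + 1) L) :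
    ContDiff ℝ n fun p : ℝ × Z => fderiv ℝ (fun x => L (p.1, x)) p.2 :=
  ContDiff.fderiv (f := fun (p : ℝ × Z) x => L (p.1, x)) (hL.comp (by fun_prop)) contDiff_snd le_rfl

theorem continuous_meanParamDeriv {L : ℝ × Z → F} (hL : ContDiff ℝ 1 L) :
    Continuous fun p : ℝ × Z × Z => meanParamDeriv L p.1 p.2.1 p.2.2 := by
  have hD := (contDiff_fderiv_param (n := 0) (by simpa using hL)).continuous
  exact intervalIntegral.continuous_parametric_intervalIntegral_of_continuous'
    (f := fun (p : ℝ × Z × Z) r =>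
      fderiv ℝ (fun x => L (p.1, x)) (p.2.1 + r • (p.2.2 - p.2.1)))
    (hD.comp (by fun_prop : Continuous fun q : (ℝ × Z × Z) × ℝ =>
      (q.1.1, q.1.2.1 + q.2 • (q.1.2.2 - q.1.2.1)))) 0 1

theorem meanParamDeriv_self [CompleteSpace F] (L : ℝ × Z → F) (s : ℝ) (z : Z) :
    meanParamDeriv L s z z = fderiv ℝ (fun x => L (s, x)) z := by
  simp [meanParamDeriv]

theorem meanParamDeriv_apply_sub [CompleteSpace F] {L : ℝ × Z → F} (hL : ContDiff ℝ 1 L)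
    (s : ℝ) (z y : Z) : meanParamDeriv L s z y (y - z) = L (s, y) - L (s, z) := by
  have hLs : ContDiff ℝ 1 fun x => L (s, x) := hL.comp (by fun_prop)
  have hint : IntervalIntegrable (fun r : ℝ => fderiv ℝ (fun x => L (s, x)) (z + r • (y - z)))
      MeasureTheory.volume 0 1 :=
    ((hLs.continuous_fderiv one_ne_zero).comp (by fun_prop)).intervalIntegrable 0 1
  have htaylor := map_add_eq_sum_add_integral_iteratedFDeriv (n := 0) (x := z) (y := y - z)
    (f := fun x => L (s, x)) fun t _ => by simpa using hLs.contDiffAt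
  simp only [add_sub_cancel, zero_add, Finset.range_one, Finset.sum_singleton, Nat.factorial_zero,
    Nat.cast_one, inv_one, one_smul, pow_zero, iteratedFDeriv_zero_apply] at htaylor
  rw [meanParamDeriv, ContinuousLinearMap.intervalIntegral_apply hint, htaylor,
    add_sub_cancel_left]
  simp

/-- The coefficient of the linear system `∂_s w = a w`, `∂_s q = b ∘ q + (m ·) w` for a pair of
`w : F` and a derivative `q : Z →L[ℝ] F`. -/
noncomputable def variationCoeff (a b : F →L[ℝ] F) (m : Z →L[ℝ] F →L[ℝ] F) :
    (F × (Z →L[ℝ] F)) →L[ℝ] (F × (Z →L[ℝ] F)) :=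
  .inl ℝ F (Z →L[ℝ] F) ∘L a ∘L .fst ℝ F (Z →L[ℝ] F) + .inr ℝ F (Z →L[ℝ] F) ∘L
    (.compL ℝ Z F F b ∘L .snd ℝ F (Z →L[ℝ] F) + m.flip ∘L .fst ℝ F (Z →L[ℝ] F))

theorem variationCoeff_apply (a b : F →L[ℝ] F) (m : Z →L[ℝ] F →L[ℝ] F) (w : F)
    (q : Z →L[ℝ] F) : variationCoeff a b m (w, q) = (a w, b ∘L q + m.flip w) := by
  simp [variationCoeff]

theorem contDiff_variationCoeff {X : Type*} [NormedAddCommGroup X] [NormedSpace ℝ X]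
    {n : WithTop ℕ∞} {a b : X → F →L[ℝ] F} {m : X → Z →L[ℝ] F →L[ℝ] F} (ha : ContDiff ℝ n a)
    (hb : ContDiff ℝ n b) (hm : ContDiff ℝ n m) :
    ContDiff ℝ n fun x => variationCoeff (a x) (b x) (m x) := by
  have hcompL : ContDiff ℝ n fun x => ContinuousLinearMap.compL ℝ Z F F (b x) :=
    contDiff_const.clm_apply hb
  have hflip : ContDiff ℝ n fun x => (m x).flip := by
    have hflipCLM : ContDiff ℝ n fun l : Z →L[ℝ] F →L[ℝ] F => l.flip :=
      IsBoundedLinearMap.contDiff ⟨⟨ContinuousLinearMap.flip_add, ContinuousLinearMap.flip_smul⟩,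
        1, one_pos, fun l => by simp [ContinuousLinearMap.opNorm_flip]⟩
    exact hflipCLM.comp hm
  unfold variationCoeff
  fun_prop

variable [CompleteSpace F]

theorem sub_eq_paramQuotient_apply {L : ℝ × Z → F →L[ℝ] F}
    (hL : ContDiff ℝ 1 L) {y₀ : F} {Y : ℝ → Z → F} (h₀ : ∀ z, Y 0 z = y₀)
    (hY : ∀ s z, HasDerivAt (fun r => Y r z) (L (s, z) (Y s z)) s) {z y : Z}
    {Q : ℝ → Z →L[ℝ] F} (hQ₀ : Q 0 = 0) (hQ : ∀ s, HasDerivAt Q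
      (L (s, z) ∘L Q s + (meanParamDeriv L s z y).flip (Y s y)) s) (s : ℝ) :
    Y s y - Y s z = Q s (y - z) := by
  refine sub_eq_zero.1 (congrFun (linearODE_unique (L := fun s => L (s, z))
    (hL.continuous.comp (by fun_prop)) (f := fun s => Y s y - Y s z - Q s (y - z))
    (g := fun _ => 0) (fun r => ?_) (fun r => ?_) (t₀ := 0) (by simp [h₀, hQ₀])) s)
  · refine (((hY r y).sub (hY r z)).sub
      ((hQ r).clm_apply (hasDerivAt_const r (y - z)))).congr_deriv ?_
    rw [add_apply, ContinuousLinearMap.comp_apply, map_zero, add_zero,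
      ContinuousLinearMap.flip_apply, meanParamDeriv_apply_sub hL, sub_apply]
    simp only [map_sub]
    abel
  · simpa using hasDerivAt_const r (0 : F)

variable [FiniteDimensional ℝ Z]

/- The difference quotients in the parameter solve a linear equation with continuous coefficients
themselves, so they extend continuously to the diagonal, where they are the derivative. -/
theorem exists_hasFDerivAt_linearODE_solution {L : ℝ × Z → F →L[ℝ] F} (hL : ContDiff ℝ 1 L)
    {y₀ : F} {Y : ℝ → Z → F} (h₀ : ∀ z, Y 0 z = y₀)
    (hY : ∀ s z, HasDerivAt (fun r => Y r z) (L (s, z) (Y s z)) s) :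
    ∃ P : ℝ → Z → Z →L[ℝ] F, (∀ z, P 0 z = 0) ∧ (∀ s z, HasFDerivAt (Y s) (P s z) z) ∧
      ∀ s z, HasDerivAt (fun r => (Y r z, P r z)) (variationCoeff (L (s, z)) (L (s, z))
        (fderiv ℝ (fun x => L (s, x)) z) (Y s z, P s z)) s := by
  have hcoeff : Continuous fun p : ℝ × Z × Z =>
      variationCoeff (L (p.1, p.2.2)) (L (p.1, p.2.1)) (meanParamDeriv L p.1 p.2.1 p.2.2) := by
    have hvar := (contDiff_variationCoeff (n := 0)
      (X := (F →L[ℝ] F) × (F →L[ℝ] F) × (Z →L[ℝ] F →L[ℝ] F)) contDiff_fst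
      (contDiff_fst.comp contDiff_snd) (contDiff_snd.comp contDiff_snd)).continuous
    have hLc := hL.continuous
    exact hvar.comp (f := fun p : ℝ × Z × Z =>
      (L (p.1, p.2.2), L (p.1, p.2.1), meanParamDeriv L p.1 p.2.1 p.2.2))
      (.prodMk (by fun_prop) (.prodMk (by fun_prop) (continuous_meanParamDeriv hL)))
  obtain ⟨W, hWc, hW₀, hW⟩ :=
    exists_continuous_linearODE_solution hcoeff ((y₀, 0) : F × (Z →L[ℝ] F))
  have hfst : ∀ z y, (fun s => (W s (z, y)).1) = fun s => Y s y := fun z y =>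
    linearODE_unique (L := fun s => L (s, y)) (hL.continuous.comp (by fun_prop))
      (fun s => (ContinuousLinearMap.fst ℝ F (Z →L[ℝ] F)).hasFDerivAt.comp_hasDerivAt s
        ((hW s (z, y)).congr_deriv (variationCoeff_apply _ _ _ _ _)))
      (fun s => hY s y) (t₀ := 0) (by simp [hW₀, h₀])
  have hpair : ∀ z y s, W s (z, y) = (Y s y, (W s (z, y)).2) := fun z y s =>
    Prod.ext (congrFun (hfst z y) s) rfl
  have hsnd : ∀ z y s, HasDerivAt (fun r => (W r (z, y)).2) (L (s, z) ∘L (W s (z, y)).2 +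
      (meanParamDeriv L s z y).flip (Y s y)) s := fun z y s => by
    have hWs := hW s (z, y)
    rw [hpair z y s, variationCoeff_apply] at hWs
    exact (ContinuousLinearMap.snd ℝ F (Z →L[ℝ] F)).hasFDerivAt.comp_hasDerivAt s hWs
  refine ⟨fun s z => (W s (z, z)).2, by simp [hW₀], fun s z => ?_, fun s z => ?_⟩
  · exact hasFDerivAt_of_sub_eq_apply (q := fun y => (W s (z, y)).2)
      (hWc.comp (by fun_prop : Continuous fun y : Z => (s, (z, y)))).snd.continuousAt
      fun y => sub_eq_paramQuotient_apply hL h₀ hY (by simp [hW₀]) (hsnd z y) s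
  · have hWs := hW s (z, z)
    rw [funext (hpair z z), hpair z z s, meanParamDeriv_self] at hWs
    exact hWs

theorem contDiff_linearODE_solution (m : ℕ) {Z F : Type u} [NormedAddCommGroup Z]
    [NormedSpace ℝ Z] [FiniteDimensional ℝ Z] [NormedAddCommGroup F] [NormedSpace ℝ F]
    [CompleteSpace F] {L : ℝ × Z → F →L[ℝ] F} (hL : ContDiff ℝ m L) {y₀ : F} {Y : ℝ → Z → F}
    (h₀ : ∀ z, Y 0 z = y₀) (hY : ∀ s z, HasDerivAt (fun r => Y r z) (L (s, z) (Y s z)) s)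
    (s : ℝ) : ContDiff ℝ m (Y s) := by
  induction m generalizing F s with
  | zero =>
    obtain ⟨W, hWc, hW₀, hW⟩ := exists_continuous_linearODE_solution hL.continuous y₀
    have hWY : ∀ z, (fun s => W s z) = fun s => Y s z := fun z =>
      linearODE_unique (L := fun s => L (s, z)) (hL.continuous.comp (by fun_prop))
        (fun s => hW s z) (fun s => hY s z) (t₀ := 0) (by simp [hW₀, h₀])
    have hYs : Y s = fun z => W s z := funext fun z => (congrFun (hWY z) s).symm
    rw [hYs]
    exact contDiff_zero.2 (hWc.comp (by fun_prop : Continuous fun z : Z => (s, z)))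
  | succ m ih =>
    obtain ⟨P, hP₀, hP, hYP⟩ :=
      exists_hasFDerivAt_linearODE_solution (hL.of_le (by simp)) h₀ hY
    have hLm : ContDiff ℝ m L := hL.of_le (by simp)
    have hYPs := ih (contDiff_variationCoeff hLm hLm (contDiff_fderiv_param (n := m) hL))
      (y₀ := ((y₀, 0) : F × (Z →L[ℝ] F))) (fun z => by simp [h₀, hP₀]) hYP s
    push_cast
    refine contDiff_succ_iff_fderiv.2 ⟨fun z => (hP s z).differentiableAt, by simp, ?_⟩
    rw [funext fun z => (hP s z).fderiv]
    exact hYPs.snd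

/- Rescaling time, `Y(s, (t, x)) = w(t₀ + s (t - t₀), x)`, turns the time into a parameter. -/
theorem exists_contDiff_linearODE_solution {L : ℝ × Z → F →L[ℝ] F} (hL : ContDiff ℝ ∞ L)
    (t₀ : ℝ) (y₀ : F) :
    ∃ w : ℝ × Z → F, ContDiff ℝ ∞ w ∧ (∀ x, w (t₀, x) = y₀) ∧
      ∀ t x, HasDerivAt (fun r => w (r, x)) (L (t, x) (w (t, x))) t := by
  obtain ⟨W, -, hW₀, hW⟩ := exists_continuous_linearODE_solution
    (L := fun p : ℝ × Z => L (t₀ + p.1, p.2)) (hL.continuous.comp (by fun_prop)) y₀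
  have hrescaled : ∀ (s : ℝ) (z : ℝ × Z), HasDerivAt (fun r => W (r * (z.1 - t₀)) z.2)
      (((z.1 - t₀) • L (t₀ + s * (z.1 - t₀), z.2)) (W (s * (z.1 - t₀)) z.2)) s := fun s z => by
    simpa [Function.comp_def] using HasDerivAt.scomp s (hW (s * (z.1 - t₀)) z.2)
      ((hasDerivAt_id s).mul_const (z.1 - t₀))
  have hcoeff : ContDiff ℝ ∞ fun p : ℝ × ℝ × Z =>
      (p.2.1 - t₀) • L (t₀ + p.1 * (p.2.1 - t₀), p.2.2) :=
    ContDiff.smul (f := fun p : ℝ × ℝ × Z => p.2.1 - t₀) (by fun_prop) (hL.comp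
      (f := fun p : ℝ × ℝ × Z => (t₀ + p.1 * (p.2.1 - t₀), p.2.2)) (by fun_prop))
  refine ⟨fun z => W (z.1 - t₀) z.2, contDiff_infty.2 fun m => ?_, fun x => by simp [hW₀],
    fun t x => ?_⟩
  · simpa using contDiff_linearODE_solution m
      (Y := fun s (z : ℝ × Z) => W (s * (z.1 - t₀)) z.2)
      (y₀ := y₀) (hcoeff.of_le (mod_cast le_top)) (fun z => by simp [hW₀]) hrescaled 1
  · simpa using (hW (t - t₀) x).comp_sub_const t t₀

end ParameterDerivative

section AffineODE

variable {Z F : Type u} [NormedAddCommGroup Z] [NormedSpace ℝ Z] [FiniteDimensional ℝ Z]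
  [NormedAddCommGroup F] [NormedSpace ℝ F] [CompleteSpace F]

/- The inhomogeneity becomes a coefficient of the linear system for the pair `(w, 1)`. -/
theorem exists_contDiff_affineODE_solution {L : ℝ × Z → F →L[ℝ] F} {γ : ℝ × Z → F}
    (hL : ContDiff ℝ ∞ L) (hγ : ContDiff ℝ ∞ γ) (t₀ : ℝ) :
    ∃ w : ℝ × Z → F, ContDiff ℝ ∞ w ∧ (∀ x, w (t₀, x) = 0) ∧
      ∀ t x, HasDerivAt (fun r => w (r, x)) (L (t, x) (w (t, x)) + γ (t, x)) t := by
  let M : ℝ × Z → F × ℝ →L[ℝ] F × ℝ := fun z =>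
    .inl ℝ F ℝ ∘L (L z ∘L .fst ℝ F ℝ + (ContinuousLinearMap.snd ℝ F ℝ).smulRight (γ z))
  obtain ⟨w, hw, hw₀, hwM⟩ := exists_contDiff_linearODE_solution (L := M)
    (by unfold M; fun_prop) t₀ (0, 1)
  have hM : ∀ z y, M z y = (L z y.1 + y.2 • γ z, 0) := fun z y => by simp [M]
  have hsnd : ∀ t x, (w (t, x)).2 = 1 := fun t x => by
    have hderiv : ∀ s, HasDerivAt (fun r => (w (r, x)).2) 0 s := fun s => by
      have hwMs : HasDerivAt _ (M (s, x) (w (s, x))).2 s := (hwM s x).snd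
      rwa [hM] at hwMs
    simpa [hw₀] using is_const_of_deriv_eq_zero (fun s => (hderiv s).differentiableAt)
      (fun s => (hderiv s).deriv) t t₀
  refine ⟨fun z => (w z).1, hw.fst, fun x => by simp [hw₀], fun t x => ?_⟩
  have hwMt : HasDerivAt _ (M (t, x) (w (t, x))).1 t := (hwM t x).fst
  rwa [hM, hsnd, one_smul] at hwMt

end AffineODE

/-! ### Solutions of differential equations in a closed set and in a matrix group -/

section InvariantSet

variable {F : Type*} [NormedAddCommGroup F] [NormedSpace ℝ F] [ProperSpace F]

/- The distance to `S` grows at most exponentially: compare `W` with the curve through the point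
of `S` closest to it. -/
theorem mem_of_hasDerivAt_of_tangent {S : Set F} (hS : IsClosed S) {v : ℝ → F → F} {K : NNReal}
    {s₀ s₁ : ℝ} (hs : s₀ ≤ s₁) (hv : ∀ s ∈ Icc s₀ s₁, LipschitzWith K (v s))
    (htangent : ∀ s ∈ Icc s₀ s₁, ∀ g ∈ S,
      ∃ E : ℝ → F, E 0 = g ∧ (∀ t, E t ∈ S) ∧ HasDerivAt E (v s g) 0)
    {W : ℝ → F} (hW : ∀ s ∈ Icc s₀ s₁, HasDerivAt W (v s (W s)) s) (h₀ : W s₀ ∈ S) :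
    W s₁ ∈ S := by
  have hgronwall := le_gronwallBound_of_liminf_deriv_right_le
    (f := fun s => Metric.infDist (W s) S) (f' := fun s => K * Metric.infDist (W s) S)
    (δ := 0) (K := K) (ε := 0) (a := s₀) (b := s₁)
    (fun s hs => ((Metric.continuous_infDist_pt _).continuousAt.comp
      (hW s hs).continuousAt).continuousWithinAt) (fun s hs r hr => ?_)
    (Metric.infDist_zero_of_mem h₀).le (by simp) s₁ ⟨hs, le_rfl⟩
  · rw [gronwallBound_ε0_δ0] at hgronwall
    exact (hS.mem_iff_infDist_zero ⟨_, h₀⟩).2 (hgronwall.antisymm Metric.infDist_nonneg)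
  obtain ⟨g, hg, hWg⟩ := hS.exists_infDist_eq_dist ⟨_, h₀⟩ (W s)
  obtain ⟨E, hE₀, hES, hE⟩ := htangent s (Ico_subset_Icc_self hs) g hg
  have hdiff : HasDerivAt (fun t => W t - E (t - s)) (v s (W s) - v s g) s :=
    (hW s (Ico_subset_Icc_self hs)).sub (HasDerivAt.comp_sub_const s s (by rwa [sub_self]))
  have hspeed : ‖v s (W s) - v s g‖ < r := by
    rw [← dist_eq_norm]
    exact ((hv s (Ico_subset_Icc_self hs)).dist_le_mul _ _).trans_lt (hWg ▸ hr)
  refine ((hdiff.hasDerivWithinAt.liminf_right_slope_norm_le hspeed).and_eventually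
    self_mem_nhdsWithin).mono fun t ht => lt_of_le_of_lt ?_ ht.1
  have hst : 0 < t - s := sub_pos.2 ht.2
  gcongr
  · rw [← dist_eq_norm]
    exact Metric.infDist_le_dist_of_mem (hES _)
  · rw [sub_self, hE₀, ← dist_eq_norm, hWg]

end InvariantSet

section MatrixGroup

variable {R : Type*} [NormedRing R] {a b W : ℝ → R} {s₀ s₁ : ℝ}

theorem exists_lipschitzWith_mul_sub_mul (ha : ContinuousOn a (Icc s₀ s₁))
    (hb : ContinuousOn b (Icc s₀ s₁)) :
    ∃ K, ∀ s ∈ Icc s₀ s₁, LipschitzWith K fun g => g * b s - a s * g := by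
  obtain ⟨Ma, hMa⟩ := isCompact_Icc.exists_bound_of_continuousOn ha
  obtain ⟨Mb, hMb⟩ := isCompact_Icc.exists_bound_of_continuousOn hb
  refine ⟨(Ma + Mb).toNNReal, fun s hs => LipschitzWith.of_dist_le' fun g h => ?_⟩
  rw [dist_eq_norm, dist_eq_norm]
  calc ‖g * b s - a s * g - (h * b s - a s * h)‖
      = ‖(g - h) * b s - a s * (g - h)‖ := by congr 1; noncomm_ring
    _ ≤ ‖(g - h) * b s‖ + ‖a s * (g - h)‖ := norm_sub_le _ _
    _ ≤ ‖g - h‖ * ‖b s‖ + ‖a s‖ * ‖g - h‖ := by gcongr <;> exact norm_mul_le _ _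
    _ ≤ ‖g - h‖ * Mb + Ma * ‖g - h‖ := by
      gcongr
      exacts [hMb s hs, hMa s hs]
    _ = (Ma + Mb) * ‖g - h‖ := by ring

variable [NormedAlgebra ℝ R]

theorem eq_zero_of_hasDerivAt_mul_sub_mul [ProperSpace R] (hs : s₀ ≤ s₁)
    (ha : ContinuousOn a (Icc s₀ s₁)) (hb : ContinuousOn b (Icc s₀ s₁))
    (hW : ∀ s ∈ Icc s₀ s₁, HasDerivAt W (W s * b s - a s * W s) s) (h₀ : W s₀ = 0) :
    W s₁ = 0 := by
  obtain ⟨K, hK⟩ := exists_lipschitzWith_mul_sub_mul ha hb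
  refine mem_of_hasDerivAt_of_tangent (S := {0}) isClosed_singleton hs hK
    (fun s _ g hg => ⟨fun _ => 0, hg.symm, fun _ => rfl, ?_⟩) hW h₀
  simpa [show g = 0 from hg] using hasDerivAt_const (0 : ℝ) (0 : R)

theorem hasDerivAt_exp_neg_smul_mul_mul_exp_smul [CompleteSpace R] (X Y g : R) :
    HasDerivAt (fun t : ℝ => NormedSpace.exp (-t • X) * g * NormedSpace.exp (t • Y))
      (g * Y - X * g) 0 := by
  have hX : HasDerivAt (fun t : ℝ => NormedSpace.exp (-t • X)) (-X) 0 := by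
    simpa using hasDerivAt_exp_smul_const (𝕂 := ℝ) (-X) 0
  have hY : HasDerivAt (fun t : ℝ => NormedSpace.exp (t • Y)) Y 0 := by
    simpa using hasDerivAt_exp_smul_const (𝕂 := ℝ) Y 0
  refine ((hX.mul_const g).mul hY).congr_deriv ?_
  simp only [neg_zero, zero_smul, NormedSpace.exp_zero, one_mul, mul_one, neg_mul]
  abel

/- A left inverse is provided by the solution of `V' = V a - b V`, since
`(V W - 1)' = (V W - 1) b - b (V W - 1)`. -/
theorem exists_mul_eq_one_of_hasDerivAt [ProperSpace R] (hs : s₀ ≤ s₁) (ha : Continuous a)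
    (hb : Continuous b) (hW : ∀ s ∈ Icc s₀ s₁, HasDerivAt W (W s * b s - a s * W s) s)
    {V₀ : R} (h₀ : V₀ * W s₀ = 1) : ∃ V, V * W s₁ = 1 := by
  obtain ⟨Y, -, hY₀, hY⟩ := exists_continuous_linearODE_solution (Z := Unit)
    (L := fun p => (ContinuousLinearMap.mul ℝ R).flip (a (s₀ + p.1)) -
      ContinuousLinearMap.mul ℝ R (b (s₀ + p.1))) (by fun_prop) V₀
  have hV : ∀ s, HasDerivAt (fun r => Y (r - s₀) ())
      (Y (s - s₀) () * a s - b s * Y (s - s₀) ()) s := fun s => by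
    simpa using (hY (s - s₀) ()).comp_sub_const s s₀
  refine ⟨Y (s₁ - s₀) (), sub_eq_zero.1 (eq_zero_of_hasDerivAt_mul_sub_mul
    (W := fun s => Y (s - s₀) () * W s - 1) hs hb.continuousOn hb.continuousOn
    (fun s hs => (((hV s).mul (hW s hs)).sub_const 1).congr_deriv ?_) (by simp [hY₀, h₀]))⟩
  noncomm_ring

variable {n : ℕ} {G : Subgroup (Matrix.GeneralLinearGroup (Fin n) ℂ)}

/-- The set of matrices underlying a group of invertible matrices. -/
def matrixSet (G : Subgroup (Matrix.GeneralLinearGroup (Fin n) ℂ)) : Set (Mat n) :=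
  (fun g : Matrix.GeneralLinearGroup (Fin n) ℂ => (g : Mat n)) '' (G : Set _)

theorem mul_mul_mem_closure_matrixSet {X Y g : Mat n} (hX : X ∈ matrixSet G)
    (hg : g ∈ closure (matrixSet G)) (hY : Y ∈ matrixSet G) :
    X * g * Y ∈ closure (matrixSet G) := by
  refine map_mem_closure (f := fun g => X * g * Y) (by fun_prop) hg ?_
  obtain ⟨x, hx, rfl⟩ := hX
  obtain ⟨y, hy, rfl⟩ := hY
  rintro - ⟨g, hg, rfl⟩
  exact ⟨x * g * y, G.mul_mem (G.mul_mem hx hg) hy, by simp⟩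

theorem exp_smul_mem_matrixSet {X : Mat n} (hX : X ∈ lieAlg G) (t : ℝ) :
    NormedSpace.exp (t • X) ∈ matrixSet G := by
  obtain ⟨g, hg, hgX⟩ := hX t
  exact ⟨g, hg, hgX⟩

theorem coe_mem_closure_matrixSet_iff {g : Matrix.GeneralLinearGroup (Fin n) ℂ} :
    (g : Mat n) ∈ closure (matrixSet G) ↔ g ∈ closure (G : Set _) := by
  rw [Units.isOpenEmbedding_val.isInducing.closure_eq_preimage_closure_image]
  rfl

theorem mem_matrixSet_of_hasDerivAt
    (hG : IsClosed (G : Set (Matrix.GeneralLinearGroup (Fin n) ℂ))) {a b W : ℝ → Mat n}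
    (hs : s₀ ≤ s₁) (ha : Continuous a) (hb : Continuous b)
    (haG : ∀ s ∈ Icc s₀ s₁, a s ∈ lieAlg G) (hbG : ∀ s ∈ Icc s₀ s₁, b s ∈ lieAlg G)
    (hW : ∀ s ∈ Icc s₀ s₁, HasDerivAt W (W s * b s - a s * W s) s) (h₀ : W s₀ ∈ matrixSet G) :
    W s₁ ∈ matrixSet G := by
  obtain ⟨K, hK⟩ := exists_lipschitzWith_mul_sub_mul ha.continuousOn hb.continuousOn
  have hclosure : W s₁ ∈ closure (matrixSet G) :=
    mem_of_hasDerivAt_of_tangent isClosed_closure hs hK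
      (fun s hs g hg => ⟨fun t => NormedSpace.exp (-t • a s) * g * NormedSpace.exp (t • b s),
        by simp, fun t => mul_mul_mem_closure_matrixSet (exp_smul_mem_matrixSet (haG s hs) (-t)) hg
          (exp_smul_mem_matrixSet (hbG s hs) t),
        hasDerivAt_exp_neg_smul_mul_mul_exp_smul (a s) (b s) g⟩) hW (subset_closure h₀)
  obtain ⟨g₀, -, hg₀⟩ := h₀
  obtain ⟨V, hV⟩ := exists_mul_eq_one_of_hasDerivAt hs ha hb hW
    (V₀ := (g₀⁻¹ : Matrix.GeneralLinearGroup (Fin n) ℂ)) (by simp [← hg₀])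
  obtain ⟨g, hg⟩ : IsUnit (W s₁) := IsUnit.of_mul_eq_one_right _ hV
  rw [← hg, coe_mem_closure_matrixSet_iff, hG.closure_eq] at hclosure
  exact ⟨g, hclosure, hg⟩

end MatrixGroup

/-! ### Geometry of the diamond -/

section Diamond

/-- The open causal diamond. -/
def openDiamond : Set Spacetime := {z | ‖z.2‖ < z.1 + 1 ∧ ‖z.2‖ < 1 - z.1}

theorem isOpen_openDiamond : IsOpen openDiamond := by
  unfold openDiamond
  exact (isOpen_lt (f := fun z : Spacetime => ‖z.2‖) (by fun_prop) (by fun_prop)).inter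
    (isOpen_lt (f := fun z : Spacetime => ‖z.2‖) (by fun_prop) (by fun_prop))

theorem openDiamond_subset_diamond : openDiamond ⊆ diamond := fun _ hz => ⟨hz.1.le, hz.2.le⟩

theorem isClosed_diamond : IsClosed diamond := by
  unfold diamond
  exact (isClosed_le (f := fun z : Spacetime => ‖z.2‖) (by fun_prop) (by fun_prop)).inter
    (isClosed_le (f := fun z : Spacetime => ‖z.2‖) (by fun_prop) (by fun_prop))

theorem isCompact_diamond : IsCompact diamond := by
  refine Metric.isCompact_of_isClosed_isBounded isClosed_diamond
    ((Metric.isBounded_closedBall (x := (0 : Spacetime)) (r := 1)).subset fun z hz => ?_)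
  have hz₂ := norm_nonneg z.2
  rw [mem_closedBall_zero_iff, norm_prod_le_iff, Real.norm_eq_abs, abs_le]
  exact ⟨⟨by linarith [hz.1], by linarith [hz.2]⟩, by linarith [hz.1, hz.2]⟩

theorem convex_diamond : Convex ℝ diamond := by
  have hnorm : ConvexOn ℝ univ fun z : Spacetime => ‖z.2‖ :=
    convexOn_univ_norm.comp_linearMap (LinearMap.snd ℝ ℝ (EuclideanSpace ℝ (Fin 3)))
  have hfst : ConcaveOn ℝ univ fun z : Spacetime => z.1 :=
    (LinearMap.fst ℝ ℝ (EuclideanSpace ℝ (Fin 3))).concaveOn convex_univ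
  have hneg : ConcaveOn ℝ univ fun z : Spacetime => -z.1 :=
    (-LinearMap.fst ℝ ℝ (EuclideanSpace ℝ (Fin 3))).concaveOn convex_univ
  convert (hnorm.sub (hfst.add_const 1)).convex_le 0 |>.inter
    ((hnorm.sub (hneg.add_const 1)).convex_le 0) using 1
  ext z
  simp only [diamond, mem_ofPred_eq, mem_inter_iff, mem_univ, true_and, Pi.sub_apply, Pi.add_apply]
  constructor <;> rintro ⟨h₁, h₂⟩ <;> constructor <;> linarith

theorem smul_mem_openDiamond {z : Spacetime} (hz : z ∈ diamond) {s : ℝ} (hs : s ∈ Ico 0 1) :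
    s • z ∈ openDiamond := by
  have hlower := mul_le_mul_of_nonneg_left hz.1 hs.1
  have hupper := mul_le_mul_of_nonneg_left hz.2 hs.1
  simp only [openDiamond, mem_ofPred_eq, Prod.smul_snd, Prod.smul_fst, smul_eq_mul,
    norm_smul_of_nonneg hs.1]
  constructor <;> linarith [hs.2]

theorem uniqueDiffOn_diamond : UniqueDiffOn ℝ diamond :=
  uniqueDiffOn_convex convex_diamond ⟨0, interior_maximal openDiamond_subset_diamond
    isOpen_openDiamond (by simp [openDiamond])⟩

theorem diamond_subset_closure_openDiamond : diamond ⊆ closure openDiamond := by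
  intro z hz
  have hcont : ContinuousWithinAt (fun s : ℝ => s • z) (Ico 0 1) 1 := by fun_prop
  have hclosure := hcont.mem_closure_image (by simp)
  rw [one_smul] at hclosure
  refine closure_mono ?_ hclosure
  rintro - ⟨s, hs, rfl⟩
  exact smul_mem_openDiamond hz hs

end Diamond

/-! ### The energy estimate -/

section Divergence

theorem indicator_eventuallyEq_zero {E F : Type*} [TopologicalSpace E] [Zero F] {O K : Set E}
    {g : E → F} (hK : IsClosed K) (hKO : K ⊆ O) (hg : ∀ z ∈ O, z ∉ K → g z = 0) {z : E}
    (hz : z ∉ O) : O.indicator g =ᶠ[nhds z] 0 := by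
  filter_upwards [hK.isOpen_compl.mem_nhds fun h => hz (hKO h)] with y hy
  exact indicator_apply_eq_zero.2 fun hyO => hg y hyO hy

variable {E F : Type*} [NormedAddCommGroup E] [NormedSpace ℝ E] [NormedAddCommGroup F]
  [NormedSpace ℝ F] {O K : Set E} {g : E → F}

theorem fderiv_indicator_of_eq_zero (hO : IsOpen O) (hK : IsClosed K) (hKO : K ⊆ O)
    (hg : ∀ z ∈ O, z ∉ K → g z = 0) :
    fderiv ℝ (O.indicator g) = O.indicator (fderiv ℝ g) := by
  ext1 z
  by_cases hz : z ∈ O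
  · rw [indicator_of_mem hz, (eqOn_indicator.eventuallyEq_of_mem (hO.mem_nhds hz)).fderiv_eq]
  · rw [indicator_of_notMem hz, (indicator_eventuallyEq_zero hK hKO hg hz).fderiv_eq]
    simp

theorem contDiff_indicator_of_eq_zero {n : WithTop ℕ∞} (hgn : ContDiff ℝ n g) (hO : IsOpen O)
    (hK : IsClosed K) (hKO : K ⊆ O) (hg : ∀ z ∈ O, z ∉ K → g z = 0) :
    ContDiff ℝ n (O.indicator g) := by
  refine contDiff_iff_contDiffAt.2 fun z => ?_
  by_cases hz : z ∈ O
  · exact hgn.contDiffAt.congr_of_eventuallyEq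
      (eqOn_indicator.eventuallyEq_of_mem (hO.mem_nhds hz))
  · exact contDiffAt_const.congr_of_eventuallyEq (indicator_eventuallyEq_zero hK hKO hg hz)

variable [FiniteDimensional ℝ E] [MeasurableSpace E] [BorelSpace E]
  (μ : MeasureTheory.Measure E) [μ.IsAddHaarMeasure]

theorem integral_fderiv_apply_eq_zero {g : E → ℝ} (hg : ContDiff ℝ 1 g)
    (hsupp : HasCompactSupport g) (v : E) : ∫ z, fderiv ℝ g z v ∂μ = 0 := by
  have hcont : Continuous fun z => fderiv ℝ g z v :=
    (hg.continuous_fderiv one_ne_zero).clm_apply continuous_const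
  simpa using integral_mul_fderiv_eq_neg_fderiv_mul_of_integrable (μ := μ)
    (f := fun _ : E => (1 : ℝ)) (g := g) (v := v) (by simp)
    (by simpa using hcont.integrable_of_hasCompactSupport (hsupp.fderiv_apply ℝ v))
    (by simpa using hg.continuous.integrable_of_hasCompactSupport hsupp)
    (fun x _ => differentiableAt_const _) (fun x _ => hg.differentiable one_ne_zero x)

theorem setIntegral_fderiv_apply_eq_zero {g : E → ℝ} (hg : ContDiff ℝ 1 g) (hO : IsOpen O)
    (hK : IsCompact K) (hKO : K ⊆ O) (hgK : ∀ z ∈ O, z ∉ K → g z = 0) (v : E) :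
    ∫ z in O, fderiv ℝ g z v ∂μ = 0 := by
  have hsupp : HasCompactSupport (O.indicator g) :=
    .intro hK fun z hz => indicator_apply_eq_zero.2 fun hzO => hgK z hzO hz
  have hzero := integral_fderiv_apply_eq_zero μ
    (contDiff_indicator_of_eq_zero hg hO hK.isClosed hKO hgK) hsupp v
  rw [fderiv_indicator_of_eq_zero hO hK.isClosed hKO hgK] at hzero
  rw [← MeasureTheory.integral_indicator hO.measurableSet, ← hzero]
  congr 1
  ext z
  by_cases hz : z ∈ O <;> simp [hz]

end Divergence

section Energy

/-- The partial derivative `∂_μ`. -/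
noncomputable def pd {V : Type*} [NormedAddCommGroup V] [NormedSpace ℝ V] (μ : Fin 4)
    (f : Spacetime → V) (z : Spacetime) : V :=
  fderiv ℝ f z (coordVec μ)

/-- The function `(1 - t)² - |x|² - η`, whose zero set in the diamond is a spacelike hyperboloid
for `0 < η`. -/
noncomputable def coneFun (η : ℝ) (z : Spacetime) : ℝ := (1 - z.1) ^ 2 - ‖z.2‖ ^ 2 - η

/-- The weight `exp(-κ t) h((1 - t)² - |x|² - η)` of the energy estimate, where `h` is a smooth
increasing function vanishing exactly on the negative half-line. -/
noncomputable def energyWeight (κ η : ℝ) (z : Spacetime) : ℝ :=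
  Real.exp (-κ * z.1) * expNegInvGlue (coneFun η z)

theorem contDiff_coneFun {n : WithTop ℕ∞} (η : ℝ) : ContDiff ℝ n (coneFun η) := by
  unfold coneFun
  have hsq : ContDiff ℝ n fun z : Spacetime => ‖z.2‖ ^ 2 := contDiff_snd.norm_sq ℝ
  fun_prop

theorem contDiff_energyWeight {n : ℕ∞} (κ η : ℝ) : ContDiff ℝ n (energyWeight κ η) := by
  unfold energyWeight
  exact ContDiff.mul (by fun_prop) (expNegInvGlue.contDiff.comp (contDiff_coneFun η))

theorem energyWeight_nonneg (κ η : ℝ) (z : Spacetime) : 0 ≤ energyWeight κ η z :=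
  mul_nonneg (Real.exp_pos _).le (expNegInvGlue.nonneg _)

theorem hasFDerivAt_coneFun (η : ℝ) (z : Spacetime) :
    HasFDerivAt (coneFun η) ((-(2 * (1 - z.1))) • ContinuousLinearMap.fst ℝ ℝ _ -
      (2 : ℝ) • (innerSL ℝ z.2).comp (ContinuousLinearMap.snd ℝ ℝ _)) z := by
  have htime : HasFDerivAt (fun z : Spacetime => (1 - z.1) ^ 2)
      ((-(2 * (1 - z.1))) • ContinuousLinearMap.fst ℝ ℝ _) z := by
    refine ((hasFDerivAt_fst.const_sub 1).pow 2).congr_fderiv ?_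
    ext <;> simp
  refine ((htime.sub (hasFDerivAt_snd (p := z)).norm_sq).sub_const η).congr_fderiv ?_
  ext <;> simp

theorem hasFDerivAt_energyWeight (κ η : ℝ) (z : Spacetime) :
    HasFDerivAt (energyWeight κ η) ((-κ * energyWeight κ η z) • ContinuousLinearMap.fst ℝ ℝ _ +
      (Real.exp (-κ * z.1) * deriv expNegInvGlue (coneFun η z)) •
        ((-(2 * (1 - z.1))) • ContinuousLinearMap.fst ℝ ℝ _ -
      (2 : ℝ) • (innerSL ℝ z.2).comp (ContinuousLinearMap.snd ℝ ℝ _))) z := by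
  have hexp : HasFDerivAt (fun z : Spacetime => Real.exp (-κ * z.1))
      ((Real.exp (-κ * z.1) * -κ) • ContinuousLinearMap.fst ℝ ℝ _) z := by
    refine ((hasFDerivAt_fst.const_mul (-κ)).exp).congr_fderiv ?_
    ext <;> simp
  have hglue : HasDerivAt expNegInvGlue (deriv expNegInvGlue (coneFun η z)) (coneFun η z) :=
    ((expNegInvGlue.contDiff (n := 1)).differentiable (by simp) _).hasDerivAt
  refine (hexp.mul (hglue.comp_hasFDerivAt z (hasFDerivAt_coneFun η z))).congr_fderiv ?_
  ext <;> simp [energyWeight] <;> ring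

theorem pd_energyWeight_zero (κ η : ℝ) (z : Spacetime) : pd 0 (energyWeight κ η) z =
    -κ * energyWeight κ η z
      - 2 * (1 - z.1) * (Real.exp (-κ * z.1) * deriv expNegInvGlue (coneFun η z)) := by
  rw [pd, (hasFDerivAt_energyWeight κ η z).fderiv]
  simp only [coordVec, Fin.cons_zero, add_apply, smul_apply, sub_apply,
    ContinuousLinearMap.coe_fst', ContinuousLinearMap.comp_apply, ContinuousLinearMap.coe_snd',
    map_zero, smul_eq_mul]
  ring

theorem pd_energyWeight_succ (κ η : ℝ) (z : Spacetime) (i : Fin 3) :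
    pd i.succ (energyWeight κ η) z =
      - (2 * z.2 i) * (Real.exp (-κ * z.1) * deriv expNegInvGlue (coneFun η z)) := by
  rw [pd, (hasFDerivAt_energyWeight κ η z).fderiv]
  simp only [coordVec, Fin.cons_succ, add_apply, smul_apply, sub_apply,
    ContinuousLinearMap.coe_fst', ContinuousLinearMap.comp_apply, ContinuousLinearMap.coe_snd',
    innerSL_apply_apply, EuclideanSpace.inner_single_right, conj_trivial, smul_eq_mul]
  ring

theorem sum_pd_energyWeight_mul (κ η : ℝ) (z : Spacetime) (J : Fin 4 → ℝ) :
    ∑ μ, pd μ (energyWeight κ η) z * J μ = -κ * energyWeight κ η z * J 0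
      - 2 * (Real.exp (-κ * z.1) * deriv expNegInvGlue (coneFun η z)) *
        ((1 - z.1) * J 0 + ∑ i : Fin 3, z.2 i * J i.succ) := by
  simp only [Fin.sum_univ_succ, pd_energyWeight_zero, pd_energyWeight_succ]
  ring

variable {J : Fin 4 → Spacetime → ℝ} {C δ : ℝ}

theorem neg_sum_mul_flux_le {z : Spacetime} (hz : z ∈ openDiamond) {J : Fin 4 → ℝ}
    (hcausal : ∀ ξ : Fin 3 → ℝ, ∑ i, ξ i ^ 2 ≤ 1 → -∑ i, ξ i * J i.succ ≤ J 0) :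
    -∑ i, z.2 i * J i.succ ≤ (1 - z.1) * J 0 := by
  have ht : 0 < 1 - z.1 := (norm_nonneg z.2).trans_lt hz.2
  have hscaled := hcausal (fun i => z.2 i / (1 - z.1)) (by
    simp only [div_pow]
    rw [← Finset.sum_div, div_le_one (by positivity), ← EuclideanSpace.real_norm_sq_eq]
    gcongr
    exact hz.2.le)
  calc -∑ i, z.2 i * J i.succ = (1 - z.1) * -∑ i, z.2 i / (1 - z.1) * J i.succ := by
        rw [mul_neg, Finset.mul_sum]
        congr! 2 with i
        field_simp
    _ ≤ (1 - z.1) * J 0 := by gcongr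

/- The weight decreases in time and along the outgoing normals of the backward light cones, so all
terms that do not come from the divergence of `J` have a sign. -/
theorem sum_pd_energyWeight_mul_le (hJ : ∀ μ, ContDiff ℝ 1 (J μ)) (η : ℝ) {z : Spacetime}
    (hz : z ∈ openDiamond)
    (hcausal : ∀ ξ : Fin 3 → ℝ, ∑ i, ξ i ^ 2 ≤ 1 → -∑ i, ξ i * J i.succ z ≤ J 0 z)
    (hdiv : ∑ μ, pd μ (J μ) z ≤ C * J 0 z) :
    ∑ μ, pd μ (fun z => energyWeight (C + 1) η z * J μ z) z
      ≤ -(energyWeight (C + 1) η z * J 0 z) := by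
  have hproduct : ∀ μ, pd μ (fun z => energyWeight (C + 1) η z * J μ z) z =
      energyWeight (C + 1) η z * pd μ (J μ) z + pd μ (energyWeight (C + 1) η) z * J μ z := by
    intro μ
    simp only [pd]
    rw [fderiv_fun_mul ((contDiff_energyWeight (n := 1) _ _).differentiable one_ne_zero z)
      ((hJ μ).differentiable one_ne_zero z)]
    simp only [add_apply, smul_apply, smul_eq_mul]
    ring
  rw [Finset.sum_congr rfl fun μ _ => hproduct μ, Finset.sum_add_distrib, ← Finset.mul_sum,
    sum_pd_energyWeight_mul _ _ _ fun μ => J μ z]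
  have hdecay : 0 ≤ Real.exp (-(C + 1) * z.1) * deriv expNegInvGlue (coneFun η z) :=
    mul_nonneg (Real.exp_pos _).le expNegInvGlue.monotone.deriv_nonneg
  have hflux := neg_sum_mul_flux_le hz (J := fun μ => J μ z) hcausal
  have hdiv' := mul_le_mul_of_nonneg_left hdiv (energyWeight_nonneg (C + 1) η z)
  have hflux' := mul_nonneg (mul_nonneg zero_le_two hdecay) (sub_nonneg.2 hflux)
  linarith

theorem isCompact_diamond_inter_coneFun_nonneg (δ η : ℝ) :
    IsCompact (diamond ∩ ({z | δ ≤ z.1 + 1 - ‖z.2‖} ∩ {z | 0 ≤ coneFun η z})) :=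
  isCompact_diamond.inter_right ((isClosed_le continuous_const (by fun_prop)).inter
    (isClosed_le continuous_const (contDiff_coneFun (n := 0) η).continuous))

theorem diamond_inter_coneFun_nonneg_subset {δ η : ℝ} (hδ : 0 < δ) (hη : 0 < η) :
    diamond ∩ ({z | δ ≤ z.1 + 1 - ‖z.2‖} ∩ {z | 0 ≤ coneFun η z}) ⊆ openDiamond := by
  rintro z ⟨hz, hlower, hcone⟩
  simp only [mem_ofPred_eq, coneFun] at hlower hcone
  exact ⟨by linarith,
    lt_of_pow_lt_pow_left₀ 2 ((norm_nonneg z.2).trans hz.2) (by linarith)⟩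

theorem setIntegral_pd_energyWeight_mul {f : Spacetime → ℝ} (hf : ContDiff ℝ 1 f) {η : ℝ}
    (hδ : 0 < δ) (hη : 0 < η) (hlow : ∀ z ∈ openDiamond, z.1 + 1 - ‖z.2‖ < δ → f z = 0) (κ : ℝ)
    (μ : Fin 4) : ∫ z in openDiamond, pd μ (fun z => energyWeight κ η z * f z) z = 0 := by
  have hHaar : (MeasureTheory.volume : MeasureTheory.Measure Spacetime).IsAddHaarMeasure := by
    rw [MeasureTheory.Measure.volume_eq_prod]
    infer_instance
  refine setIntegral_fderiv_apply_eq_zero _ ((contDiff_energyWeight (n := 1) κ η).mul hf)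
    isOpen_openDiamond (isCompact_diamond_inter_coneFun_nonneg δ η)
    (diamond_inter_coneFun_nonneg_subset hδ hη) (fun z hz hzK => ?_) (coordVec μ)
  by_cases hzδ : z.1 + 1 - ‖z.2‖ < δ
  · rw [hlow z hz hzδ, mul_zero]
  · have hcone : coneFun η z < 0 := not_le.1 fun h =>
      hzK ⟨openDiamond_subset_diamond hz, not_lt.1 hzδ, h⟩
    rw [energyWeight, expNegInvGlue.zero_of_nonpos hcone.le, mul_zero, zero_mul]

theorem eqOn_zero_of_setIntegral_nonpos {f : Spacetime → ℝ} (hf : Continuous f)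
    (hf₀ : ∀ z ∈ openDiamond, 0 ≤ f z) (hint : ∫ z in openDiamond, f z ≤ 0) :
    EqOn f 0 openDiamond := by
  have hmeas := isOpen_openDiamond.measurableSet
  refine MeasureTheory.Measure.eqOn_open_of_ae_eq (μ := MeasureTheory.volume) ?_
    isOpen_openDiamond hf.continuousOn continuousOn_const
  exact (MeasureTheory.setIntegral_eq_zero_iff_of_nonneg_ae
    ((MeasureTheory.ae_restrict_iff' hmeas).2 (.of_forall hf₀))
    ((hf.continuousOn.integrableOn_compact isCompact_diamond).mono_set
      openDiamond_subset_diamond)).1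
    (hint.antisymm (MeasureTheory.setIntegral_nonneg hmeas hf₀))

theorem energyDensity_eq_zero (hJ : ∀ μ, ContDiff ℝ 1 (J μ))
    (hcausal : ∀ z ∈ openDiamond, ∀ ξ : Fin 3 → ℝ, ∑ i, ξ i ^ 2 ≤ 1 →
      -∑ i, ξ i * J i.succ z ≤ J 0 z)
    (hdiv : ∀ z ∈ openDiamond, ∑ μ, pd μ (J μ) z ≤ C * J 0 z) (hδ : 0 < δ)
    (hlow : ∀ z ∈ openDiamond, z.1 + 1 - ‖z.2‖ < δ → ∀ μ, J μ z = 0) {z : Spacetime}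
    (hz : z ∈ openDiamond) : J 0 z = 0 := by
  obtain ⟨η, hη, hcone⟩ : ∃ η, 0 < η ∧ 0 < coneFun η z := by
    have hsq : ‖z.2‖ ^ 2 < (1 - z.1) ^ 2 := by gcongr; exact hz.2
    exact ⟨((1 - z.1) ^ 2 - ‖z.2‖ ^ 2) / 2, by linarith, by unfold coneFun; linarith⟩
  have hwJ : ∀ μ, ContDiff ℝ 1 fun z => energyWeight (C + 1) η z * J μ z := fun μ =>
    (contDiff_energyWeight (n := 1) (C + 1) η).mul (hJ μ)
  have hintegrable : ∀ {f : Spacetime → ℝ}, Continuous f →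
      MeasureTheory.IntegrableOn f openDiamond := fun hf =>
    (hf.continuousOn.integrableOn_compact isCompact_diamond).mono_set openDiamond_subset_diamond
  have hpd : ∀ μ, MeasureTheory.IntegrableOn
      (pd μ fun z => energyWeight (C + 1) η z * J μ z) openDiamond := fun μ =>
    hintegrable (((hwJ μ).continuous_fderiv one_ne_zero).clm_apply continuous_const)
  have hnonpos : ∫ z in openDiamond, energyWeight (C + 1) η z * J 0 z ≤ 0 := by
    have hle := MeasureTheory.setIntegral_mono_on
      (MeasureTheory.integrable_finsetSum _ fun μ _ => hpd μ) (hintegrable (hwJ 0).continuous).neg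
      isOpen_openDiamond.measurableSet
      fun z hz => sum_pd_energyWeight_mul_le hJ η hz (hcausal z hz) (hdiv z hz)
    rw [MeasureTheory.integral_finsetSum _ fun μ _ => hpd μ, Finset.sum_eq_zero fun μ _ =>
      setIntegral_pd_energyWeight_mul (hJ μ) hδ hη (fun z hz hzδ => hlow z hz hzδ μ) _ μ,
      MeasureTheory.integral_neg'] at hle
    linarith
  have hzero := eqOn_zero_of_setIntegral_nonpos (hwJ 0).continuous (fun z hz =>
    mul_nonneg (energyWeight_nonneg _ _ z) (by simpa using hcausal z hz 0 (by simp))) hnonpos hz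
  exact (mul_eq_zero.1 hzero).resolve_left
    (mul_pos (Real.exp_pos _) (expNegInvGlue.pos_of_pos hcone)).ne'

end Energy

/-! ### The Hodge star in coordinates -/

section Hodge

theorem det_of_fin_four {R : Type*} [CommRing R] (m : Fin 4 → Fin 4 → R) :
    Matrix.det (Matrix.of m) =
      (m 0 0 * m 1 1 - m 0 1 * m 1 0) * (m 2 2 * m 3 3 - m 2 3 * m 3 2)
      - (m 0 0 * m 1 2 - m 0 2 * m 1 0) * (m 2 1 * m 3 3 - m 2 3 * m 3 1)
      + (m 0 0 * m 1 3 - m 0 3 * m 1 0) * (m 2 1 * m 3 2 - m 2 2 * m 3 1)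
      + (m 0 1 * m 1 2 - m 0 2 * m 1 1) * (m 2 0 * m 3 3 - m 2 3 * m 3 0)
      - (m 0 1 * m 1 3 - m 0 3 * m 1 1) * (m 2 0 * m 3 2 - m 2 2 * m 3 0)
      + (m 0 2 * m 1 3 - m 0 3 * m 1 2) * (m 2 0 * m 3 1 - m 2 1 * m 3 0) := by
  rw [Matrix.det_succ_row_zero]
  simp [Fin.sum_univ_succ, Matrix.det_fin_three, Fin.succAbove]
  ring

/-- The Levi-Civita symbol `ε_{abcd}`, as the determinant of the rows `a, b, c, d` of the identity
matrix. -/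
def leviCivita (a b c d : Fin 4) : ℤ :=
  Matrix.det (Matrix.of fun r s => if ![a, b, c, d] r = s then 1 else 0)

theorem coords_coordVec (a b : Fin 4) : coords (coordVec a) b = if a = b then 1 else 0 := by
  refine Fin.cases ?_ (fun i => ?_) a <;> refine Fin.cases ?_ (fun j => ?_) b
  · simp [coords, coordVec]
  · simp [coords, coordVec, (Fin.succ_ne_zero j).symm]
  · simp [coords, coordVec]
  · simp [coords, coordVec, eq_comm]

theorem vol_coordVec (a b c d : Fin 4) :
    vol ![coordVec a, coordVec b, coordVec c, coordVec d] = leviCivita a b c d := by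
  rw [vol, leviCivita, Int.cast_det]
  congr 1
  ext r s
  have hr : ![coordVec a, coordVec b, coordVec c, coordVec d] r = coordVec (![a, b, c, d] r) := by
    fin_cases r <;> rfl
  simp [hr, coords_coordVec]

theorem joinVec_two_two (v w : Fin 2 → Spacetime) :
    joinVec (k := 2) (m := 2) rfl v w = ![v 0, v 1, w 0, w 1] := by
  ext1 a
  fin_cases a <;> rfl

theorem joinVec_three_one (v : Fin 3 → Spacetime) (w : Fin 1 → Spacetime) :
    joinVec (k := 3) (m := 1) rfl v w = ![v 0, v 1, v 2, w 0] := by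
  ext1 a
  fin_cases a <;> rfl

theorem sum_fin_two_arrow {α V : Type*} [Fintype α] [AddCommMonoid V] (f : (Fin 2 → α) → V) :
    ∑ i, f i = ∑ a, ∑ b, f ![a, b] := by
  rw [← Fintype.sum_prod_type' (f := fun a b => f ![a, b])]
  exact (Fintype.sum_equiv (finTwoArrowEquiv α).symm _ _ fun _ => rfl).symm

theorem sum_fin_three_arrow {α V : Type*} [Fintype α] [AddCommMonoid V] (f : (Fin 3 → α) → V) :
    ∑ i, f i = ∑ a, ∑ b, ∑ c, f ![a, b, c] := by
  calc ∑ i, f i = ∑ a, ∑ j : Fin 2 → α, f (Fin.cons a j) := by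
        rw [← Fintype.sum_prod_type' (f := fun a (j : Fin 2 → α) => f (Fin.cons a j))]
        exact (Fintype.sum_equiv (Fin.consEquiv fun _ : Fin 3 => α) _ _ fun _ => rfl).symm
    _ = ∑ a, ∑ b, ∑ c, f ![a, b, c] :=
        Fintype.sum_congr _ _ fun a => sum_fin_two_arrow fun j : Fin 2 → α => f (Fin.cons a j)

variable {F : Type*} [NormedAddCommGroup F] [NormedSpace ℝ F]

theorem hodgeStar_apply {k m : ℕ} (h : k + m = 4) (η : Spacetime [⋀^Fin k]→L[ℝ] F)
    (v : Fin m → Spacetime) :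
    hodgeStar h η v = (k.factorial : ℝ)⁻¹ • ∑ i : Fin k → Fin 4, (∏ a, metricDiag (i a)) •
      vol (joinVec h (fun a => coordVec (i a)) v) • η fun a => coordVec (i a) := by
  simp only [hodgeStar, ContinuousAlternatingMap.smul_apply, ContinuousAlternatingMap.sum_apply]
  rfl

theorem differentiableOn_hodgeStar {k m : ℕ} (h : k + m = 4) {s : Set Spacetime}
    {η : Spacetime → Spacetime [⋀^Fin k]→L[ℝ] F}
    (hη : ∀ i : Fin k → Fin 4, DifferentiableOn ℝ (fun y => η y fun a => coordVec (i a)) s) :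
    DifferentiableOn ℝ (fun y => hodgeStar h (η y)) s := by
  have hcomp : ∀ i : Fin k → Fin 4, DifferentiableOn ℝ (fun y =>
      (ContinuousLinearMap.toSpanSingleton ℝ
        (η y fun a => coordVec (i a))).compContinuousAlternatingMap
          (volContract h fun a => coordVec (i a))) s := fun i =>
    ((ContinuousLinearMap.compContinuousAlternatingMapCLM ℝ Spacetime ℝ F (Fin m)).flip
      (volContract h fun a => coordVec (i a)) ∘L
        ContinuousLinearMap.toSpanSingletonCLE.toContinuousLinearMap).differentiable
      |>.comp_differentiableOn (hη i)
  unfold hodgeStar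
  fun_prop

/-- The components `½ ε_{abcd} T^{ab}` of the Hodge star of the 2-form with components `T_{ab}`. -/
noncomputable def starComponents {V : Type*} [AddCommGroup V] [Module ℝ V] (T : Fin 4 → Fin 4 → V)
    (c d : Fin 4) : V :=
  (2 : ℝ)⁻¹ • ∑ a, ∑ b, (metricDiag a * metricDiag b * leviCivita a b c d) • T a b

theorem hodgeStar_two_apply_coordVec (η : Spacetime [⋀^Fin 2]→L[ℝ] F) (c d : Fin 4) :
    hodgeStar (k := 2) (m := 2) rfl η ![coordVec c, coordVec d] =
      starComponents (fun a b => η ![coordVec a, coordVec b]) c d := by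
  have hcoord : ∀ a b, (fun k => coordVec (![a, b] k)) = ![coordVec a, coordVec b] := fun a b =>
    List.ofFn_inj.1 rfl
  rw [hodgeStar_apply, sum_fin_two_arrow, starComponents]
  simp [joinVec_two_two, hcoord, vol_coordVec, smul_smul, Fin.prod_univ_two]

theorem starComponents_of_antisymm {V : Type*} [AddCommGroup V] [Module ℝ V]
    {T : Fin 4 → Fin 4 → V} (hT : ∀ a b, T b a = -T a b) :
    starComponents T 0 1 = T 2 3 ∧ starComponents T 0 2 = -T 1 3 ∧ starComponents T 0 3 = T 1 2 ∧
      starComponents T 1 2 = -T 0 3 ∧ starComponents T 1 3 = T 0 2 ∧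
      starComponents T 2 3 = -T 0 1 := by
  have h₀ : metricDiag 0 = -1 := rfl
  have h₁ : metricDiag 1 = 1 := rfl
  have h₂ : metricDiag 2 = 1 := rfl
  have h₃ : metricDiag 3 = 1 := rfl
  refine ⟨?_, ?_, ?_, ?_, ?_, ?_⟩ <;>
  · simp only [starComponents, Fin.sum_univ_four, leviCivita, det_of_fin_four, h₀, h₁, h₂, h₃,
      hT 0 1, hT 0 2, hT 0 3, hT 1 2, hT 1 3, hT 2 3, Matrix.cons_val, Fin.isValue, Fin.reduceEq,
      ↓reduceIte]
    push_cast
    module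

theorem hodgeStar_three_apply_coordVec (η : Spacetime [⋀^Fin 3]→L[ℝ] F) (d : Fin 4) :
    hodgeStar (k := 3) (m := 1) rfl η ![coordVec d] = (6 : ℝ)⁻¹ •
      ∑ a, ∑ b, ∑ c, (metricDiag a * metricDiag b * metricDiag c * leviCivita a b c d) •
        η ![coordVec a, coordVec b, coordVec c] := by
  have hcoord : ∀ a b c, (fun k => coordVec (![a, b, c] k)) =
      ![coordVec a, coordVec b, coordVec c] := fun a b c => List.ofFn_inj.1 rfl
  rw [hodgeStar_apply, sum_fin_three_arrow]
  simp [joinVec_three_one, vol_coordVec, hcoord, Nat.factorial, smul_smul, Fin.prod_univ_three]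

section AlternatingThree

variable {E V : Type*} [AddCommGroup E] [Module ℝ E] [TopologicalSpace E] [AddCommGroup V]
  [Module ℝ V] [TopologicalSpace V] (η : E [⋀^Fin 3]→L[ℝ] V) (x y z : E)

theorem alternating_three_swap_left : η ![y, x, z] = -η ![x, y, z] := by
  have hswap : ![y, x, z] = ![x, y, z] ∘ Equiv.swap 0 1 := by
    ext1 k; fin_cases k <;> simp [Equiv.swap_apply_def]
  rw [hswap]
  exact η.toAlternatingMap.map_swap _ (by decide)

theorem alternating_three_swap_right : η ![x, z, y] = -η ![x, y, z] := by
  have hswap : ![x, z, y] = ![x, y, z] ∘ Equiv.swap 1 2 := by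
    ext1 k; fin_cases k <;> simp [Equiv.swap_apply_def]
  rw [hswap]
  exact η.toAlternatingMap.map_swap _ (by decide)

theorem alternating_three_antisymmetrize :
    η ![x, y, z] - η ![x, z, y] - η ![y, x, z] + η ![y, z, x] + η ![z, x, y] - η ![z, y, x]
      = (6 : ℝ) • η ![x, y, z] := by
  rw [alternating_three_swap_right η z x y, alternating_three_swap_left η x z y,
    alternating_three_swap_right η y x z, alternating_three_swap_right η x y z,
    alternating_three_swap_left η x y z]
  module

end AlternatingThree

theorem hodgeStar_three_apply_space (η : Spacetime [⋀^Fin 3]→L[ℝ] F) :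
    hodgeStar (k := 3) (m := 1) rfl η ![coordVec 1] = -η ![coordVec 0, coordVec 2, coordVec 3] ∧
      hodgeStar (k := 3) (m := 1) rfl η ![coordVec 2] = η ![coordVec 0, coordVec 1, coordVec 3] ∧
      hodgeStar (k := 3) (m := 1) rfl η ![coordVec 3] =
        -η ![coordVec 0, coordVec 1, coordVec 2] := by
  have h₀ : metricDiag 0 = -1 := rfl
  have h₁ : metricDiag 1 = 1 := rfl
  have h₂ : metricDiag 2 = 1 := rfl
  have h₃ : metricDiag 3 = 1 := rfl
  have hsix := fun a b c =>
    alternating_three_antisymmetrize η (coordVec a) (coordVec b) (coordVec c)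
  simp only [hodgeStar_three_apply_coordVec, Fin.sum_univ_four, leviCivita, det_of_fin_four, h₀, h₁,
    h₂, h₃, Matrix.cons_val, Fin.isValue, Fin.reduceEq, ↓reduceIte]
  push_cast
  refine ⟨?_, ?_, ?_⟩
  · linear_combination (norm := module) (-6 : ℝ)⁻¹ • hsix 0 2 3
  · linear_combination (norm := module) (6 : ℝ)⁻¹ • hsix 0 1 3
  · linear_combination (norm := module) (-6 : ℝ)⁻¹ • hsix 0 1 2

end Hodge

/-! ### Covariant derivatives and curvature in coordinates -/

section PartialDerivative

variable {V : Type*} [NormedAddCommGroup V] [NormedSpace ℝ V] {f g : Spacetime → V}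
  {z : Spacetime}

theorem contDiff_pd (hf : ContDiff ℝ ∞ f) (μ : Fin 4) : ContDiff ℝ ∞ (pd μ f) :=
  (hf.fderiv_right (m := ∞) (by simp)).clm_apply contDiff_const

theorem pd_add (hf : DifferentiableAt ℝ f z) (hg : DifferentiableAt ℝ g z) (μ : Fin 4) :
    pd μ (fun y => f y + g y) z = pd μ f z + pd μ g z := by
  simp [pd, fderiv_fun_add hf hg]

theorem pd_sub (hf : DifferentiableAt ℝ f z) (hg : DifferentiableAt ℝ g z) (μ : Fin 4) :
    pd μ (fun y => f y - g y) z = pd μ f z - pd μ g z := by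
  simp [pd, fderiv_fun_sub hf hg]

theorem pd_neg (μ : Fin 4) : pd μ (-f) z = -pd μ f z := by
  simp [pd, fderiv_neg]

theorem pd_const (c : V) (μ : Fin 4) : pd μ (fun _ => c) z = 0 := by
  simp [pd]

theorem pd_sum {ι : Type*} [Fintype ι] {f : ι → Spacetime → V}
    (hf : ∀ i, DifferentiableAt ℝ (f i) z) (μ : Fin 4) :
    pd μ (fun y => ∑ i, f i y) z = ∑ i, pd μ (f i) z := by
  simp [pd, fderiv_fun_sum fun i _ => hf i]

theorem pd_clm_comp {W : Type*} [NormedAddCommGroup W] [NormedSpace ℝ W] (Φ : V →L[ℝ] W)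
    (hf : DifferentiableAt ℝ f z) (μ : Fin 4) : pd μ (fun y => Φ (f y)) z = Φ (pd μ f z) :=
  congrArg (fun ℓ => ℓ (coordVec μ)) (Φ.hasFDerivAt.comp z hf.hasFDerivAt).fderiv

theorem pd_mul {R : Type*} [NormedRing R] [NormedAlgebra ℝ R] {X Y : Spacetime → R}
    (hX : DifferentiableAt ℝ X z) (hY : DifferentiableAt ℝ Y z) (μ : Fin 4) :
    pd μ (fun y => X y * Y y) z = pd μ X z * Y z + X z * pd μ Y z := by
  simp [pd, fderiv_fun_mul' hX hY, add_comm]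

open scoped RealInnerProductSpace in
theorem pd_inner {H : Type*} [NormedAddCommGroup H] [InnerProductSpace ℝ H] {f g : Spacetime → H}
    (hf : DifferentiableAt ℝ f z) (hg : DifferentiableAt ℝ g z) (μ : Fin 4) :
    pd μ (fun y => ⟪f y, g y⟫) z = ⟪f z, pd μ g z⟫ + ⟪pd μ f z, g z⟫ :=
  fderiv_inner_apply ℝ hf hg _

open scoped RealInnerProductSpace in
theorem pd_norm_sq {H : Type*} [NormedAddCommGroup H] [InnerProductSpace ℝ H] {f : Spacetime → H}
    (hf : DifferentiableAt ℝ f z) (μ : Fin 4) :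
    pd μ (fun y => ‖f y‖ ^ 2) z = 2 * ⟪f z, pd μ f z⟫ := by
  simp only [← real_inner_self_eq_norm_sq, pd_inner hf hf]
  rw [real_inner_comm, two_mul]

theorem pd_comm (hf : ContDiff ℝ 2 f) (μ ν : Fin 4) : pd μ (pd ν f) z = pd ν (pd μ f) z := by
  have hsecond : ∀ μ ν, pd μ (pd ν f) z = fderiv ℝ (fderiv ℝ f) z (coordVec μ) (coordVec ν) := by
    intro μ ν
    have hdiff : DifferentiableAt ℝ (fderiv ℝ f) z :=
      (hf.fderiv_right (m := 1) le_rfl).differentiable one_ne_zero z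
    unfold pd
    rw [fderiv_clm_apply hdiff (differentiableAt_const _)]
    simp
  rw [hsecond, hsecond]
  exact (hf.contDiffAt.isSymmSndFDerivAt (by simp)).eq _ _

end PartialDerivative

section Covariant

variable {R : Type*} [NormedRing R] [NormedAlgebra ℝ R] {A B C : Fin 4 → Spacetime → R}
  {X Y : Spacetime → R} {z : Spacetime}

/-- The covariant derivative `∂_μ X + A_μ X - X B_μ` of a section `X` of the bundle of
homomorphisms from a trivial bundle with connection `B` to one with connection `A`; for `A = B` it
is the covariant derivative `∂_μ X + [A_μ, X]` in the adjoint bundle. -/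
noncomputable def covD (A B : Fin 4 → Spacetime → R) (μ : Fin 4) (X : Spacetime → R)
    (z : Spacetime) : R :=
  pd μ X z + (A μ z * X z - X z * B μ z)

/-- The components `F_{μν} = ∂_μ A_ν - ∂_ν A_μ + [A_μ, A_ν]` of the curvature. -/
noncomputable def curv (A : Fin 4 → Spacetime → R) (μ ν : Fin 4) (z : Spacetime) : R :=
  pd μ (A ν) z - pd ν (A μ) z + (A μ z * A ν z - A ν z * A μ z)

/-- The components `F^A_{μν} X - X F^B_{μν}` of the curvature of the bundle of homomorphisms, acting
on a section `X`. -/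
noncomputable def homCurv (A B : Fin 4 → Spacetime → R) (X : Spacetime → R) (μ ν : Fin 4)
    (z : Spacetime) : R :=
  curv A μ ν z * X z - X z * curv B μ ν z

theorem curv_swap (A : Fin 4 → Spacetime → R) (μ ν : Fin 4) : curv A ν μ = -curv A μ ν := by
  ext z
  simp only [curv, Pi.neg_apply]
  abel

theorem contDiff_covD (hA : ∀ μ, ContDiff ℝ ∞ (A μ)) (hB : ∀ μ, ContDiff ℝ ∞ (B μ))
    (hX : ContDiff ℝ ∞ X) (μ : Fin 4) : ContDiff ℝ ∞ (covD A B μ X) :=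
  (contDiff_pd hX μ).add (((hA μ).mul hX).sub (hX.mul (hB μ)))

theorem contDiff_curv (hA : ∀ μ, ContDiff ℝ ∞ (A μ)) (μ ν : Fin 4) :
    ContDiff ℝ ∞ (curv A μ ν) :=
  ((contDiff_pd (hA ν) μ).sub (contDiff_pd (hA μ) ν)).add
    (((hA μ).mul (hA ν)).sub ((hA ν).mul (hA μ)))

theorem covD_neg (μ : Fin 4) : covD A B μ (-X) z = -covD A B μ X z := by
  simp only [covD, pd_neg, Pi.neg_apply, mul_neg, neg_mul]
  abel

theorem covD_zero (μ : Fin 4) : covD A B μ 0 z = 0 := by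
  simp [covD, pd]

theorem covD_sub (hX : DifferentiableAt ℝ X z) (hY : DifferentiableAt ℝ Y z) (μ : Fin 4) :
    covD A B μ (fun y => X y - Y y) z = covD A B μ X z - covD A B μ Y z := by
  simp only [covD, pd_sub hX hY]
  noncomm_ring

theorem covD_mul (B : Fin 4 → Spacetime → R) (hX : DifferentiableAt ℝ X z)
    (hY : DifferentiableAt ℝ Y z) (μ : Fin 4) :
    covD A C μ (fun y => X y * Y y) z = covD A B μ X z * Y z + X z * covD B C μ Y z := by
  simp only [covD, pd_mul hX hY]
  noncomm_ring

theorem pd_covD (hA : ∀ μ, DifferentiableAt ℝ (A μ) z) (hB : ∀ μ, DifferentiableAt ℝ (B μ) z)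
    (hX : ContDiff ℝ 2 X) (μ ν : Fin 4) :
    pd μ (covD A B ν X) z = pd μ (pd ν X) z + ((pd μ (A ν) z * X z + A ν z * pd μ X z)
      - (pd μ X z * B ν z + X z * pd μ (B ν) z)) := by
  have hX' : DifferentiableAt ℝ X z := hX.differentiable two_ne_zero z
  have hdX : DifferentiableAt ℝ (pd ν X) z :=
    ((hX.fderiv_right (m := 1) le_rfl).clm_apply contDiff_const).differentiable one_ne_zero z
  unfold covD
  rw [pd_add hdX (((hA ν).fun_mul hX').fun_sub (hX'.fun_mul (hB ν))),
    pd_sub ((hA ν).fun_mul hX') (hX'.fun_mul (hB ν)), pd_mul (hA ν) hX', pd_mul hX' (hB ν)]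

theorem covD_covD_sub_covD_covD (hA : ∀ μ, DifferentiableAt ℝ (A μ) z)
    (hB : ∀ μ, DifferentiableAt ℝ (B μ) z) (hX : ContDiff ℝ 2 X) (μ ν : Fin 4) :
    covD A B μ (covD A B ν X) z - covD A B ν (covD A B μ X) z =
      homCurv A B X μ ν z := by
  have houter : ∀ μ ν, covD A B μ (covD A B ν X) z = pd μ (covD A B ν X) z
      + (A μ z * covD A B ν X z - covD A B ν X z * B μ z) := fun _ _ => rfl
  rw [houter, houter, pd_covD hA hB hX, pd_covD hA hB hX, pd_comm hX μ ν]
  simp only [covD, curv, homCurv]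
  noncomm_ring

theorem pd_curv (hA : ∀ μ, ContDiff ℝ 2 (A μ)) (lam μ ν : Fin 4) :
    pd lam (curv A μ ν) z = pd lam (pd μ (A ν)) z - pd lam (pd ν (A μ)) z
      + ((pd lam (A μ) z * A ν z + A μ z * pd lam (A ν) z)
        - (pd lam (A ν) z * A μ z + A ν z * pd lam (A μ) z)) := by
  have hA' : ∀ μ, DifferentiableAt ℝ (A μ) z := fun μ => (hA μ).differentiable two_ne_zero z
  have hdA : ∀ μ ν, DifferentiableAt ℝ (pd μ (A ν)) z := fun μ ν =>
    (((hA ν).fderiv_right (m := 1) le_rfl).clm_apply contDiff_const).differentiable one_ne_zero z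
  unfold curv
  rw [pd_add ((hdA μ ν).fun_sub (hdA ν μ)) (((hA' μ).fun_mul (hA' ν)).fun_sub
      ((hA' ν).fun_mul (hA' μ))), pd_sub (hdA μ ν) (hdA ν μ),
    pd_sub ((hA' μ).fun_mul (hA' ν)) ((hA' ν).fun_mul (hA' μ)), pd_mul (hA' μ) (hA' ν),
    pd_mul (hA' ν) (hA' μ)]

theorem bianchi (hA : ∀ μ, ContDiff ℝ 2 (A μ)) (lam μ ν : Fin 4) :
    covD A A lam (curv A μ ν) z + covD A A μ (curv A ν lam) z
      + covD A A ν (curv A lam μ) z = 0 := by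
  simp only [covD, pd_curv hA, pd_comm (hA ν) lam μ, pd_comm (hA μ) lam ν, pd_comm (hA lam) μ ν]
  simp only [curv]
  noncomm_ring

end Covariant

/-! ### The Yang–Mills equations in coordinates -/

section Components

variable {n : ℕ}

/-- The component `A_μ = A(∂_μ)` of a 1-form. -/
noncomputable def component (A : Spacetime → Spacetime →L[ℝ] Mat n) (μ : Fin 4)
    (z : Spacetime) : Mat n :=
  A z (coordVec μ)

theorem contDiff_component {A : Spacetime → Spacetime →L[ℝ] Mat n} {m : WithTop ℕ∞}
    (hA : ContDiff ℝ m A) (μ : Fin 4) : ContDiff ℝ m (component A μ) :=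
  hA.clm_apply contDiff_const

theorem formBracket_apply {k : ℕ} (a : Spacetime →L[ℝ] Mat n) (η : Spacetime [⋀^Fin k]→L[ℝ] Mat n)
    (v : Fin (k + 1) → Spacetime) : formBracket a η v =
      ∑ i, (-1) ^ i.val • (a (v i) * η (i.removeNth v) - η (i.removeNth v) * a (v i)) := by
  rw [formBracket, ContinuousAlternatingMap.alternatizeUncurryFin_apply]
  rfl

theorem removeNth_vecCons_two {E : Type*} (x y : E) :
    (0 : Fin 2).removeNth ![x, y] = ![y] ∧ (1 : Fin 2).removeNth ![x, y] = ![x] := by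
  constructor <;> (ext1 k; fin_cases k; rfl)

theorem removeNth_vecCons_three {E : Type*} (x y z : E) :
    (0 : Fin 3).removeNth ![x, y, z] = ![y, z] ∧ (1 : Fin 3).removeNth ![x, y, z] = ![x, z] ∧
      (2 : Fin 3).removeNth ![x, y, z] = ![x, y] := by
  refine ⟨?_, ?_, ?_⟩ <;> (ext1 k; fin_cases k <;> rfl)

theorem fderivWithin_apply_coordVec {V : Type*} [NormedAddCommGroup V] [NormedSpace ℝ V]
    {f g : Spacetime → V} {s : Set Spacetime} {z : Spacetime} (hs : UniqueDiffWithinAt ℝ s z)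
    (hg : DifferentiableAt ℝ g z) (hfg : EqOn f g s) (hz : z ∈ s) (μ : Fin 4) :
    fderivWithin ℝ f s z (coordVec μ) = pd μ g z := by
  rw [pd, fderivWithin_congr' hfg hz, hg.fderivWithin hs]

variable {A A' : Spacetime → Spacetime →L[ℝ] Mat n} {s : Set Spacetime} {z : Spacetime}

theorem curvature_apply_coordVec (hA' : Differentiable ℝ A') (hAA' : EqOn A A' s)
    (hs : UniqueDiffWithinAt ℝ s z) (hz : z ∈ s) (μ ν : Fin 4) :
    curvature s A z ![coordVec μ, coordVec ν] = curv (component A') μ ν z := by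
  have hasForm : DifferentiableWithinAt ℝ (fun y => asForm (A y)) s z :=
    ((ContinuousAlternatingMap.ofSubsingletonLIE (𝕜 := ℝ) (E := Spacetime) (F := Mat n)
      (0 : Fin 1)).toContinuousLinearEquiv.differentiable.comp hA').differentiableAt
      |>.differentiableWithinAt.congr (fun y hy => by rw [hAA' hy]; rfl) (by rw [hAA' hz]; rfl)
  have hd : ∀ μ ν, fderivWithin ℝ (fun y => asForm (A y) ![coordVec ν]) s z (coordVec μ) =
      pd μ (component A' ν) z := fun μ ν =>
    fderivWithin_apply_coordVec hs (hA'.clm_apply (differentiable_const _) z)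
      (fun y hy => congrArg (fun a => a (coordVec ν)) (hAA' hy)) hz μ
  have hval : ∀ μ, A z (coordVec μ) = component A' μ z := fun μ =>
    congrArg (fun a => a (coordVec μ)) (hAA' hz)
  have hform : ∀ v, asForm (A z) ![v] = A z v := fun _ => rfl
  rw [curvature, ContinuousAlternatingMap.add_apply, ContinuousAlternatingMap.smul_apply,
    extDerivWithin_apply hasForm hs, formBracket_apply]
  simp only [Nat.reduceAdd, Fin.sum_univ_two, removeNth_vecCons_two, Matrix.cons_val_zero,
    Matrix.cons_val_one, hd, hval, hform, curv, Fin.val_zero, Fin.val_one, pow_zero, pow_one]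
  module

theorem covDeriv_apply_coordVec {θ : Spacetime → Spacetime [⋀^Fin 2]→L[ℝ] Mat n}
    {T : Fin 4 → Fin 4 → Spacetime → Mat n} (hAA' : EqOn A A' s)
    (hθ : DifferentiableWithinAt ℝ θ s z) (hT : ∀ μ ν, DifferentiableAt ℝ (T μ ν) z)
    (hθT : ∀ μ ν, EqOn (fun y => θ y ![coordVec μ, coordVec ν]) (T μ ν) s)
    (hs : UniqueDiffWithinAt ℝ s z) (hz : z ∈ s) (a b c : Fin 4) :
    covDeriv s A θ z ![coordVec a, coordVec b, coordVec c] =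
      covD (component A') (component A') a (T b c) z
        - covD (component A') (component A') b (T a c) z
        + covD (component A') (component A') c (T a b) z := by
  have hd : ∀ a b c, fderivWithin ℝ (fun y => θ y ![coordVec b, coordVec c]) s z (coordVec a) =
      pd a (T b c) z := fun a b c => fderivWithin_apply_coordVec hs (hT b c) (hθT b c) hz a
  have hval : ∀ b c, θ z ![coordVec b, coordVec c] = T b c z := fun b c => hθT b c hz
  rw [covDeriv, ContinuousAlternatingMap.add_apply, extDerivWithin_apply hθ hs, formBracket_apply,
    hAA' hz]
  simp only [Nat.reduceAdd, Fin.sum_univ_three, removeNth_vecCons_three, Matrix.cons_val, hd,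
    hval, covD, component, Fin.val_zero, Fin.val_one, Fin.val_two, pow_zero, pow_one]
  module

theorem covDeriv_hodgeStar_curvature_apply_coordVec (hA' : ContDiff ℝ ∞ A') (hAA' : EqOn A A' s)
    (hs : UniqueDiffOn ℝ s) (hz : z ∈ s) (a b c : Fin 4) :
    covDeriv s A (fun y => hodgeStar (k := 2) (m := 2) rfl (curvature s A y)) z
        ![coordVec a, coordVec b, coordVec c] =
      covD (component A') (component A') a (starComponents (curv (component A')) b c) z
        - covD (component A') (component A') b (starComponents (curv (component A')) a c) z
        + covD (component A') (component A') c (starComponents (curv (component A')) a b) z := by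
  have hcurv : ∀ μ ν, Differentiable ℝ (curv (component A') μ ν) := fun μ ν =>
    (contDiff_curv (contDiff_component hA') μ ν).differentiable (by simp)
  have hF : ∀ y ∈ s, ∀ μ ν,
      curvature s A y ![coordVec μ, coordVec ν] = curv (component A') μ ν y := fun y hy μ ν =>
    curvature_apply_coordVec (hA'.differentiable (by simp)) hAA' (hs y hy) hy μ ν
  have hcoord : ∀ i : Fin 2 → Fin 4,
      (fun k => coordVec (i k)) = ![coordVec (i 0), coordVec (i 1)] :=
    fun i => List.ofFn_inj.1 rfl
  refine covDeriv_apply_coordVec hAA' (differentiableOn_hodgeStar rfl (fun i => ?_) z hz)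
    (fun μ ν => ?_) (fun μ ν y hy => ?_) (hs z hz) hz a b c
  · exact (hcurv (i 0) (i 1)).differentiableOn.congr fun y hy => by rw [hcoord, hF y hy]
  · unfold starComponents
    fun_prop
  · simp only [hodgeStar_two_apply_coordVec, hF y hy, starComponents, Pi.smul_apply,
      Finset.sum_apply]

theorem SolvesYangMills.covD_curv_zero_eq_sum (hA : SolvesYangMills A) (hA' : ContDiff ℝ ∞ A')
    (hAA' : EqOn A A' diamond) (hz : z ∈ diamond) (j : Fin 3) :
    covD (component A') (component A') 0 (curv (component A') 0 j.succ) z =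
      ∑ i : Fin 3,
        covD (component A') (component A') i.succ (curv (component A') i.succ j.succ) z := by
  have hcov := covDeriv_hodgeStar_curvature_apply_coordVec hA' hAA' uniqueDiffOn_diamond hz
  set a := component A'
  obtain ⟨h₂₃, h₁₃, h₁₂⟩ := hodgeStar_three_apply_space (covDeriv diamond A
    (fun y => hodgeStar (k := 2) (m := 2) rfl (curvature diamond A y)) z)
  obtain ⟨s₀₁, s₀₂, s₀₃, s₁₂, s₁₃, s₂₃⟩ := starComponents_of_antisymm (curv_swap a)
  have hYM : hodgeStar (k := 3) (m := 1) rfl (covDeriv diamond A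
      (fun y => hodgeStar (k := 2) (m := 2) rfl (curvature diamond A y)) z) = 0 := hA z hz
  have hzero : ∀ v, (0 : Spacetime [⋀^Fin 1]→L[ℝ] Mat n) v = 0 := fun _ => rfl
  simp only [hYM, hzero, hcov, s₀₁, s₀₂, s₀₃, s₁₂, s₁₃, s₂₃, covD_neg] at h₂₃ h₁₃ h₁₂
  have hdiag : ∀ μ, curv a μ μ = 0 := by
    intro μ; ext1 y; simp [curv]
  have hsucc : (0 : Fin 3).succ = 1 ∧ (1 : Fin 3).succ = 2 ∧ (2 : Fin 3).succ = 3 := by decide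
  simp only [Fin.sum_univ_three, hsucc]
  match j with
  | 0 =>
    simp only [hsucc, hdiag, curv_swap a 1 2, curv_swap a 1 3, covD_neg, covD_zero]
    linear_combination (norm := module) (-1 : ℝ) • h₂₃
  | 1 =>
    simp only [hsucc, hdiag, curv_swap a 2 3, covD_neg, covD_zero]
    linear_combination (norm := module) (-1 : ℝ) • h₁₃
  | 2 =>
    simp only [hsucc, hdiag, covD_zero]
    linear_combination (norm := module) (-1 : ℝ) • h₁₂

end Components

/-! ### Maxwell systems with lower order terms -/

section Maxwell

open Asymptotics Filter
open scoped RealInnerProductSpace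

section Current

variable {H : Type*} [NormedAddCommGroup H] [InnerProductSpace ℝ H]

/-- The energy current `J⁰ = ∑ |a_i|² + ∑ |e_j|² + ½ ∑ |f_{ij}|²`, `Jⁱ = -2 ∑ ⟨f_{ij}, e_j⟩` of an
electric field `e`, a magnetic field `f` (an antisymmetric matrix) and a field `a` without flux. -/
noncomputable def maxwellCurrent (a e : Fin 3 → H) (f : Fin 3 → Fin 3 → H) : Fin 4 → ℝ :=
  Fin.cons (∑ i, ‖a i‖ ^ 2 + ∑ j, ‖e j‖ ^ 2 + 2⁻¹ * ∑ i, ∑ j, ‖f i j‖ ^ 2)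
    fun i => -(2 * ∑ j, ⟪f i j, e j⟫)

theorem sum_norm_sum_smul_sq_le {f : Fin 3 → Fin 3 → H} (hf : ∀ i j, f j i = -f i j)
    (ξ : Fin 3 → ℝ) :
    ∑ j, ‖∑ i, ξ i • f i j‖ ^ 2 ≤ (∑ i, ξ i ^ 2) * (2⁻¹ * ∑ i, ∑ j, ‖f i j‖ ^ 2) := by
  have hdiag : ∀ i, f i i = 0 := fun i => by
    linear_combination (norm := module) (2⁻¹ : ℝ) • hf i i
  -- Lagrange's identity: the two sides differ by the square of the scalar product of `ξ` with
  -- `(f₂₃, f₃₁, f₁₂)`.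
  have hlagrange : 0 ≤ ‖ξ 0 • f 1 2 + ξ 1 • -f 0 2 + ξ 2 • f 0 1‖ ^ 2 := by positivity
  simp only [Fin.sum_univ_three, hdiag, hf 0 1, hf 0 2, hf 1 2, ← real_inner_self_eq_norm_sq,
    inner_add_left, inner_add_right, real_inner_smul_left, real_inner_smul_right, inner_neg_left,
    inner_neg_right, inner_zero_left, inner_zero_right,
    real_inner_comm (f 0 1) (f 0 2), real_inner_comm (f 0 1) (f 1 2),
    real_inner_comm (f 0 2) (f 1 2)] at hlagrange ⊢
  linarith

theorem neg_sum_mul_maxwellCurrent_le (a e : Fin 3 → H) {f : Fin 3 → Fin 3 → H}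
    (hf : ∀ i j, f j i = -f i j) {ξ : Fin 3 → ℝ} (hξ : ∑ i, ξ i ^ 2 ≤ 1) :
    -∑ i, ξ i * maxwellCurrent a e f i.succ ≤ maxwellCurrent a e f 0 := by
  have hflux : -∑ i, ξ i * maxwellCurrent a e f i.succ = ∑ j, 2 * ⟪∑ i, ξ i • f i j, e j⟫ := by
    simp only [maxwellCurrent, Fin.cons_succ, sum_inner, real_inner_smul_left, Finset.mul_sum,
      mul_neg, Finset.sum_neg_distrib, neg_neg]
    rw [Finset.sum_comm]
    exact Finset.sum_congr rfl fun j _ => Finset.sum_congr rfl fun i _ => by ring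
  have hyoung : ∀ x y : H, 2 * ⟪x, y⟫ ≤ ‖x‖ ^ 2 + ‖y‖ ^ 2 := fun x y => by
    linarith [norm_sub_sq_real x y, sq_nonneg ‖x - y‖]
  have hmagnetic : ∑ j, ‖∑ i, ξ i • f i j‖ ^ 2 ≤ 2⁻¹ * ∑ i, ∑ j, ‖f i j‖ ^ 2 :=
    (sum_norm_sum_smul_sq_le hf ξ).trans (mul_le_of_le_one_left (by positivity) hξ)
  have ha : 0 ≤ ∑ i, ‖a i‖ ^ 2 := by positivity
  calc -∑ i, ξ i * maxwellCurrent a e f i.succ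
      ≤ ∑ j, (‖∑ i, ξ i • f i j‖ ^ 2 + ‖e j‖ ^ 2) := by
        rw [hflux]; exact Finset.sum_le_sum fun j _ => hyoung _ _
    _ ≤ maxwellCurrent a e f 0 := by
        rw [Finset.sum_add_distrib, maxwellCurrent, Fin.cons_zero]; linarith

theorem sq_norm_le_maxwellCurrent (a e : Fin 3 → H) (f : Fin 3 → Fin 3 → H) :
    ‖(a, e, f)‖ ^ 2 ≤ 2 * maxwellCurrent a e f 0 := by
  have ha : ∀ i, ‖a i‖ ^ 2 ≤ ∑ i, ‖a i‖ ^ 2 := fun i =>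
    Finset.single_le_sum (f := fun i => ‖a i‖ ^ 2) (fun _ _ => by positivity) (Finset.mem_univ i)
  have he : ∀ j, ‖e j‖ ^ 2 ≤ ∑ j, ‖e j‖ ^ 2 := fun j =>
    Finset.single_le_sum (f := fun j => ‖e j‖ ^ 2) (fun _ _ => by positivity) (Finset.mem_univ j)
  have hf : ∀ i j, ‖f i j‖ ^ 2 ≤ ∑ i, ∑ j, ‖f i j‖ ^ 2 := fun i j =>
    (Finset.single_le_sum (f := fun j => ‖f i j‖ ^ 2) (fun _ _ => by positivity)
      (Finset.mem_univ j)).trans (Finset.single_le_sum (f := fun i => ∑ j, ‖f i j‖ ^ 2)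
        (fun _ _ => by positivity) (Finset.mem_univ i))
  have ha₀ := (sq_nonneg _).trans (ha 0)
  have he₀ := (sq_nonneg _).trans (he 0)
  have hf₀ := (sq_nonneg _).trans (hf 0 0)
  rw [maxwellCurrent, Fin.cons_zero, ← Real.le_sqrt (norm_nonneg _) (by linarith), norm_prod_le_iff,
    norm_prod_le_iff, pi_norm_le_iff_of_nonneg (Real.sqrt_nonneg _),
    pi_norm_le_iff_of_nonneg (Real.sqrt_nonneg _), pi_norm_le_iff_of_nonneg (Real.sqrt_nonneg _)]
  refine ⟨fun i => Real.le_sqrt_of_sq_le ?_, fun j => Real.le_sqrt_of_sq_le ?_, fun i =>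
    (pi_norm_le_iff_of_nonneg (Real.sqrt_nonneg _)).2 fun j => Real.le_sqrt_of_sq_le ?_⟩
  · linarith [ha i]
  · linarith [he j]
  · linarith [hf i j]

end Current

section System

variable {V : Type*} [NormedAddCommGroup V] {a e : Fin 3 → Spacetime → V}
  {f : Fin 3 → Fin 3 → Spacetime → V}

/-- The values of all fields at a point. -/
def fieldValues (a e : Fin 3 → Spacetime → V) (f : Fin 3 → Fin 3 → Spacetime → V)
    (z : Spacetime) : (Fin 3 → V) × (Fin 3 → V) × (Fin 3 → Fin 3 → V) :=
  (fun i => a i z, fun j => e j z, fun i j => f i j z)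

theorem isBigO_fieldValues_iff {l : Filter Spacetime} {W : Type*} [SeminormedAddCommGroup W]
    {g : Spacetime → W} : fieldValues a e f =O[l] g ↔
      (∀ i, a i =O[l] g) ∧ (∀ j, e j =O[l] g) ∧ ∀ i j, f i j =O[l] g := by
  unfold fieldValues
  rw [isBigO_prod_left, isBigO_prod_left, isBigO_pi, isBigO_pi, isBigO_pi]
  simp only [isBigO_pi]

variable [NormedSpace ℝ V]

/-- The fields `a`, `e_j = F_{0j}`, `f_{ij} = F_{ij}` satisfy in the open diamond, up to terms
bounded by the fields themselves, the equations `∂_0 a = 0` and Maxwell's evolution equations. -/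
structure IsMaxwellSystem (a e : Fin 3 → Spacetime → V) (f : Fin 3 → Fin 3 → Spacetime → V) :
    Prop where
  antisymm : ∀ i j, f j i = -f i j
  isBigO_pd_zero : ∀ i, pd 0 (a i) =O[𝓟 openDiamond] fieldValues a e f
  isBigO_electric : ∀ j, (fun z => pd 0 (e j) z - ∑ i, pd i.succ (f i j) z)
    =O[𝓟 openDiamond] fieldValues a e f
  isBigO_magnetic : ∀ i j, (fun z => pd 0 (f i j) z - (pd i.succ (e j) z - pd j.succ (e i) z))
    =O[𝓟 openDiamond] fieldValues a e f

theorem IsMaxwellSystem.map_equiv (h : IsMaxwellSystem a e f) {W : Type*} [NormedAddCommGroup W]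
    [NormedSpace ℝ W] (Φ : V ≃L[ℝ] W) (ha : ∀ i, Differentiable ℝ (a i))
    (he : ∀ j, Differentiable ℝ (e j)) (hf : ∀ i j, Differentiable ℝ (f i j)) :
    IsMaxwellSystem (fun i z => Φ (a i z)) (fun j z => Φ (e j z)) (fun i j z => Φ (f i j z)) := by
  obtain ⟨ha', he', hf'⟩ := isBigO_fieldValues_iff.1
    (isBigO_refl (fieldValues (fun i z => Φ (a i z)) (fun j z => Φ (e j z))
      (fun i j z => Φ (f i j z))) (𝓟 openDiamond))
  have hvalues : fieldValues a e f =O[𝓟 openDiamond] fieldValues (fun i z => Φ (a i z))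
      (fun j z => Φ (e j z)) (fun i j z => Φ (f i j z)) := by
    have hΦ : ∀ g : Spacetime → V, g =O[𝓟 openDiamond] fun z => Φ (g z) := fun g =>
      Φ.isBigO_comp_rev g _
    exact isBigO_fieldValues_iff.2 ⟨fun i => (hΦ _).trans (ha' i), fun j => (hΦ _).trans (he' j),
      fun i j => (hΦ _).trans (hf' i j)⟩
  have hmap : ∀ {r : Spacetime → V}, r =O[𝓟 openDiamond] fieldValues a e f →
      (fun z => Φ (r z)) =O[𝓟 openDiamond] fieldValues (fun i z => Φ (a i z))
        (fun j z => Φ (e j z)) (fun i j z => Φ (f i j z)) := fun hr =>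
    (Φ.isBigO_comp _ _).trans (hr.trans hvalues)
  have hpd : ∀ {g : Spacetime → V}, Differentiable ℝ g → ∀ μ z,
      pd μ (fun y => Φ (g y)) z = Φ (pd μ g z) := fun hg μ z =>
    pd_clm_comp (Φ : V →L[ℝ] W) (hg z) μ
  refine ⟨fun i j => ?_, fun i => ?_, fun j => ?_, fun i j => ?_⟩
  · ext1 z
    simp [h.antisymm i j]
  · exact (hmap (h.isBigO_pd_zero i)).congr_left fun z => (hpd (ha i) 0 z).symm
  · refine (hmap (h.isBigO_electric j)).congr_left fun z => ?_
    simp only [hpd (he j), hpd (hf _ j), map_sub, map_sum]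
  · refine (hmap (h.isBigO_magnetic i j)).congr_left fun z => ?_
    simp only [hpd (he _), hpd (hf i j), map_sub]

end System

section Energy

variable {H : Type*} [NormedAddCommGroup H] [InnerProductSpace ℝ H] {a e : Fin 3 → Spacetime → H}
  {f : Fin 3 → Fin 3 → Spacetime → H} {z : Spacetime}

theorem contDiff_maxwellCurrent {m : WithTop ℕ∞} (ha : ∀ i, ContDiff ℝ m (a i))
    (he : ∀ j, ContDiff ℝ m (e j)) (hf : ∀ i j, ContDiff ℝ m (f i j)) (μ : Fin 4) :
    ContDiff ℝ m fun z => maxwellCurrent (a · z) (e · z) (f · · z) μ := by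
  refine Fin.cases ?_ (fun i => ?_) μ
  · simp only [maxwellCurrent, Fin.cons_zero]
    exact ((ContDiff.sum fun i _ => (ha i).norm_sq ℝ).add (ContDiff.sum fun j _ =>
      (he j).norm_sq ℝ)).add (contDiff_const.mul (ContDiff.sum fun i _ => ContDiff.sum fun j _ =>
        (hf i j).norm_sq ℝ))
  · simp only [maxwellCurrent, Fin.cons_succ]
    exact (contDiff_const.mul (ContDiff.sum fun j _ => (hf i j).inner ℝ (he j))).neg

theorem pd_maxwellCurrent_zero (ha : ∀ i, DifferentiableAt ℝ (a i) z)
    (he : ∀ j, DifferentiableAt ℝ (e j) z) (hf : ∀ i j, DifferentiableAt ℝ (f i j) z) :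
    pd 0 (fun y => maxwellCurrent (a · y) (e · y) (f · · y) 0) z =
      2 * ∑ i, ⟪a i z, pd 0 (a i) z⟫ + 2 * ∑ j, ⟪e j z, pd 0 (e j) z⟫
        + ∑ i, ∑ j, ⟪f i j z, pd 0 (f i j) z⟫ := by
  have ha' : ∀ i, DifferentiableAt ℝ (fun y => ‖a i y‖ ^ 2) z := fun i => (ha i).norm_sq ℝ
  have he' : ∀ j, DifferentiableAt ℝ (fun y => ‖e j y‖ ^ 2) z := fun j => (he j).norm_sq ℝ
  have hf' : ∀ i j, DifferentiableAt ℝ (fun y => ‖f i j y‖ ^ 2) z := fun i j => (hf i j).norm_sq ℝ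
  simp only [maxwellCurrent, Fin.cons_zero]
  rw [pd_add (by fun_prop) (by fun_prop), pd_add (by fun_prop) (by fun_prop),
    pd_mul (by fun_prop) (by fun_prop), pd_sum fun i => ha' i, pd_sum fun j => he' j,
    pd_sum fun i => .fun_sum fun j _ => hf' i j, pd_const]
  simp only [pd_sum (hf' _), pd_norm_sq (ha _), pd_norm_sq (he _), pd_norm_sq (hf _ _),
    ← Finset.mul_sum]
  ring

theorem pd_maxwellCurrent_succ (he : ∀ j, DifferentiableAt ℝ (e j) z)
    (hf : ∀ i j, DifferentiableAt ℝ (f i j) z) (i : Fin 3) :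
    pd i.succ (fun y => maxwellCurrent (a · y) (e · y) (f · · y) i.succ) z =
      -2 * ∑ j, (⟪e j z, pd i.succ (f i j) z⟫ + ⟪f i j z, pd i.succ (e j) z⟫) := by
  have hinner : ∀ j, DifferentiableAt ℝ (fun y => ⟪f i j y, e j y⟫) z := fun j =>
    (hf i j).inner ℝ (he j)
  simp only [maxwellCurrent, Fin.cons_succ, ← neg_mul]
  rw [pd_mul (by fun_prop) (by fun_prop), pd_sum hinner, pd_const, zero_mul, zero_add]
  simp only [pd_inner (hf i _) (he _), real_inner_comm (e _ z)]
  congr 1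
  exact Finset.sum_congr rfl fun j _ => add_comm _ _

theorem sum_pd_maxwellCurrent (ha : ∀ i, DifferentiableAt ℝ (a i) z)
    (he : ∀ j, DifferentiableAt ℝ (e j) z) (hf : ∀ i j, DifferentiableAt ℝ (f i j) z)
    (hanti : ∀ i j, f j i = -f i j) :
    ∑ μ, pd μ (fun y => maxwellCurrent (a · y) (e · y) (f · · y) μ) z =
      2 * ∑ i, ⟪a i z, pd 0 (a i) z⟫
        + 2 * ∑ j, ⟪e j z, pd 0 (e j) z - ∑ i, pd i.succ (f i j) z⟫
        + ∑ i, ∑ j, ⟪f i j z, pd 0 (f i j) z - (pd i.succ (e j) z - pd j.succ (e i) z)⟫ := by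
  have hswap : ∑ i, ∑ j, ⟪f i j z, pd j.succ (e i) z⟫ =
      -∑ i, ∑ j, ⟪f i j z, pd i.succ (e j) z⟫ := by
    rw [Finset.sum_comm]
    simp only [← Finset.sum_neg_distrib]
    refine Finset.sum_congr rfl fun i _ => Finset.sum_congr rfl fun j _ => ?_
    rw [hanti i j, Pi.neg_apply, inner_neg_left]
  have hcomm : ∑ j, ∑ i, ⟪e j z, pd i.succ (f i j) z⟫ =
      ∑ i, ∑ j, ⟪e j z, pd i.succ (f i j) z⟫ := Finset.sum_comm
  rw [Fin.sum_univ_succ, pd_maxwellCurrent_zero ha he hf]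
  simp only [pd_maxwellCurrent_succ he hf, inner_sub_right, inner_sum, Finset.sum_sub_distrib,
    Finset.sum_add_distrib, ← Finset.mul_sum, hswap, hcomm]
  ring

theorem isBigO_inner {α E E' : Type*} [SeminormedAddCommGroup E] [SeminormedAddCommGroup E']
    {l : Filter α} {x y : α → H} {g : α → E} {k : α → E'} (hx : x =O[l] g) (hy : y =O[l] k) :
    (fun t => ⟪x t, y t⟫) =O[l] fun t => ‖g t‖ * ‖k t‖ :=
  (isBoundedBilinearMap_inner (𝕜 := ℝ)).isBigO_comp.trans (hx.norm_norm.mul hy.norm_norm)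

theorem IsMaxwellSystem.sum_pd_maxwellCurrent_le (h : IsMaxwellSystem a e f)
    (ha : ∀ i, Differentiable ℝ (a i)) (he : ∀ j, Differentiable ℝ (e j))
    (hf : ∀ i j, Differentiable ℝ (f i j)) : ∃ C : ℝ, ∀ z ∈ openDiamond,
    ∑ μ, pd μ (fun y => maxwellCurrent (a · y) (e · y) (f · · y) μ) z ≤
      C * maxwellCurrent (a · z) (e · z) (f · · z) 0 := by
  obtain ⟨ha', he', hf'⟩ := isBigO_fieldValues_iff.1 (isBigO_refl (fieldValues a e f)
    (𝓟 openDiamond))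
  have hsum : (fun z => ∑ μ, pd μ (fun y => maxwellCurrent (a · y) (e · y) (f · · y) μ) z)
      =O[𝓟 openDiamond] fun z => ‖fieldValues a e f z‖ * ‖fieldValues a e f z‖ := by
    simp only [sum_pd_maxwellCurrent (fun i => ha i _) (fun j => he j _) (fun i j => hf i j _)
      h.antisymm]
    refine (IsBigO.add ?_ ?_).add ?_
    · exact (IsBigO.fun_sum fun i _ => isBigO_inner (ha' i) (h.isBigO_pd_zero i)).const_mul_left 2
    · exact (IsBigO.fun_sum fun j _ => isBigO_inner (he' j) (h.isBigO_electric j)).const_mul_left 2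
    · exact IsBigO.fun_sum fun i _ => IsBigO.fun_sum fun j _ =>
        isBigO_inner (hf' i j) (h.isBigO_magnetic i j)
  obtain ⟨C, hC, hsum⟩ := hsum.exists_nonneg
  refine ⟨C * 2, fun z hz => (le_abs_self _).trans ((isBigOWith_principal.1 hsum z hz).trans ?_)⟩
  rw [← sq, Real.norm_of_nonneg (sq_nonneg _), mul_assoc]
  gcongr
  exact sq_norm_le_maxwellCurrent _ _ _

theorem IsMaxwellSystem.eq_zero_of_inner (h : IsMaxwellSystem a e f)
    (ha : ∀ i, ContDiff ℝ 1 (a i)) (he : ∀ j, ContDiff ℝ 1 (e j))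
    (hf : ∀ i j, ContDiff ℝ 1 (f i j)) {δ : ℝ} (hδ : 0 < δ)
    (hlow : ∀ z ∈ openDiamond, z.1 + 1 - ‖z.2‖ < δ → fieldValues a e f z = 0)
    (hz : z ∈ openDiamond) : fieldValues a e f z = 0 := by
  obtain ⟨C, hC⟩ := h.sum_pd_maxwellCurrent_le (fun i => (ha i).differentiable one_ne_zero)
    (fun j => (he j).differentiable one_ne_zero) fun i j => (hf i j).differentiable one_ne_zero
  have henergy : maxwellCurrent (a · z) (e · z) (f · · z) 0 = 0 := by
    refine energyDensity_eq_zero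
      (J := fun μ y => maxwellCurrent (a · y) (e · y) (f · · y) μ)
      (fun μ => contDiff_maxwellCurrent ha he hf μ)
      (fun y _ ξ hξ => neg_sum_mul_maxwellCurrent_le _ _ (fun i j => by simp [h.antisymm i j]) hξ)
      hC hδ (fun y hy hyδ μ => ?_) hz
    obtain ⟨ha₀, he₀, hf₀⟩ : (a · y) = 0 ∧ (e · y) = 0 ∧ (f · · y) = 0 := by
      simpa [fieldValues] using hlow y hy hyδ
    rw [ha₀, he₀, hf₀]
    refine Fin.cases ?_ (fun i => ?_) μ <;> simp [maxwellCurrent]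
  rw [← norm_eq_zero, ← sq_eq_zero_iff]
  exact le_antisymm ((sq_norm_le_maxwellCurrent _ _ _).trans (by rw [henergy, mul_zero]))
    (sq_nonneg _)

theorem IsMaxwellSystem.fieldValues_eq_zero {V : Type*} [NormedAddCommGroup V] [NormedSpace ℝ V]
    [FiniteDimensional ℝ V] {a e : Fin 3 → Spacetime → V} {f : Fin 3 → Fin 3 → Spacetime → V}
    (h : IsMaxwellSystem a e f)
    (ha : ∀ i, ContDiff ℝ 1 (a i)) (he : ∀ j, ContDiff ℝ 1 (e j))
    (hf : ∀ i j, ContDiff ℝ 1 (f i j)) {δ : ℝ} (hδ : 0 < δ)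
    (hlow : ∀ z ∈ openDiamond, z.1 + 1 - ‖z.2‖ < δ → fieldValues a e f z = 0)
    (hz : z ∈ openDiamond) : fieldValues a e f z = 0 := by
  let Φ : V ≃L[ℝ] EuclideanSpace ℝ (Fin (Module.finrank ℝ V)) := toEuclidean
  have hΦ : ∀ y, fieldValues (fun i z => Φ (a i z)) (fun j z => Φ (e j z))
      (fun i j z => Φ (f i j z)) y = 0 ↔ fieldValues a e f y = 0 := fun y => by
    simp [fieldValues, funext_iff]
  exact (hΦ z).1 ((h.map_equiv Φ (fun i => (ha i).differentiable one_ne_zero)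
    (fun j => (he j).differentiable one_ne_zero)
    fun i j => (hf i j).differentiable one_ne_zero).eq_zero_of_inner
      (fun i => Φ.contDiff.comp (ha i)) (fun j => Φ.contDiff.comp (he j))
      (fun i j => Φ.contDiff.comp (hf i j)) hδ (fun y hy hyδ => (hΦ y).2 (hlow y hy hyδ)) hz)

end Energy

end Maxwell

/-! ### The Maxwell system of an intertwiner -/

section Intertwiner

open Asymptotics Filter

theorem isBigO_mul_sub_mul {R W : Type*} [NormedRing R] [SeminormedAddCommGroup W]
    {P Q Y : Spacetime → R} {g : Spacetime → W} (hP : Continuous P) (hQ : Continuous Q)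
    (hY : Y =O[𝓟 openDiamond] g) :
    (fun z => P z * Y z - Y z * Q z) =O[𝓟 openDiamond] g := by
  have hbounded : ∀ {P : Spacetime → R}, Continuous P → P =O[𝓟 openDiamond] fun _ => (1 : ℝ) :=
    fun hP => (hP.continuousOn.isBigO_principal isCompact_diamond (by simp)).mono
      (principal_mono.2 openDiamond_subset_diamond)
  have hleft := (hbounded hP).mul hY.norm_right
  have hright := hY.norm_right.mul (hbounded hQ)
  simp only [one_mul, mul_one] at hleft hright
  exact (hleft.sub hright).of_norm_right

variable {R : Type*} [NormedRing R] [NormedAlgebra ℝ R] {A B : Fin 4 → Spacetime → R}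
  {X : Spacetime → R} {z : Spacetime}

theorem contDiff_homCurv (hA : ∀ μ, ContDiff ℝ ∞ (A μ)) (hB : ∀ μ, ContDiff ℝ ∞ (B μ))
    (hX : ContDiff ℝ ∞ X) (μ ν : Fin 4) : ContDiff ℝ ∞ (homCurv A B X μ ν) :=
  ((contDiff_curv hA μ ν).mul hX).sub (hX.mul (contDiff_curv hB μ ν))

theorem homCurv_swap (A B : Fin 4 → Spacetime → R) (X : Spacetime → R) (μ ν : Fin 4) :
    homCurv A B X ν μ = -homCurv A B X μ ν := by
  ext z
  simp only [homCurv, curv_swap _ μ ν, Pi.neg_apply]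
  noncomm_ring

theorem covD_eq_zero_of_eventuallyEq (hX : X =ᶠ[nhds z] 0) (μ : Fin 4) :
    covD A B μ X z = 0 := by
  rw [covD, pd, hX.fderiv_eq, hX.eq_of_nhds]
  simp

theorem covD_homCurv (hA : ∀ μ, ContDiff ℝ ∞ (A μ)) (hB : ∀ μ, ContDiff ℝ ∞ (B μ))
    (hX : DifferentiableAt ℝ X z) (lam μ ν : Fin 4) :
    covD A B lam (homCurv A B X μ ν) z =
      covD A A lam (curv A μ ν) z * X z - X z * covD B B lam (curv B μ ν) z
        + homCurv A B (covD A B lam X) μ ν z := by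
  have hFA : DifferentiableAt ℝ (curv A μ ν) z :=
    (contDiff_curv hA μ ν).differentiable (by simp) z
  have hFB : DifferentiableAt ℝ (curv B μ ν) z :=
    (contDiff_curv hB μ ν).differentiable (by simp) z
  unfold homCurv
  rw [covD_sub (hFA.fun_mul hX) (hX.fun_mul hFB), covD_mul A hFA hX, covD_mul B hX hFB]
  abel

theorem covD_zero_covD_eq_homCurv (hA : ∀ μ, ContDiff ℝ ∞ (A μ)) (hB : ∀ μ, ContDiff ℝ ∞ (B μ))
    (hX : ContDiff ℝ ∞ X) (h₀ : ∀ z ∈ openDiamond, covD A B 0 X z = 0) (hz : z ∈ openDiamond)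
    (μ : Fin 4) : covD A B 0 (covD A B μ X) z = homCurv A B X 0 μ z := by
  rw [← covD_covD_sub_covD_covD (fun μ => (hA μ).differentiable (by simp) z)
    (fun μ => (hB μ).differentiable (by simp) z) (contDiff_infty.1 hX 2) 0 μ,
    covD_eq_zero_of_eventuallyEq
      (Filter.eventuallyEq_of_mem (isOpen_openDiamond.mem_nhds hz) h₀), sub_zero]

theorem homCurv_bianchi (hA : ∀ μ, ContDiff ℝ ∞ (A μ)) (hB : ∀ μ, ContDiff ℝ ∞ (B μ))
    (hX : DifferentiableAt ℝ X z) (lam μ ν : Fin 4) :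
    covD A B lam (homCurv A B X μ ν) z + covD A B μ (homCurv A B X ν lam) z
        + covD A B ν (homCurv A B X lam μ) z =
      homCurv A B (covD A B lam X) μ ν z + homCurv A B (covD A B μ X) ν lam z
        + homCurv A B (covD A B ν X) lam μ z := by
  have hbianchi := congrArg₂ (fun P Q => P * X z - X z * Q)
    (bianchi (z := z) (fun μ => contDiff_infty.1 (hA μ) 2) lam μ ν)
    (bianchi (z := z) (fun μ => contDiff_infty.1 (hB μ) 2) lam μ ν)
  simp only [add_mul, mul_add, zero_mul, mul_zero] at hbianchi
  rw [covD_homCurv hA hB hX, covD_homCurv hA hB hX, covD_homCurv hA hB hX]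
  linear_combination (norm := abel) hbianchi

theorem homCurv_yangMills (hA : ∀ μ, ContDiff ℝ ∞ (A μ)) (hB : ∀ μ, ContDiff ℝ ∞ (B μ))
    (hX : DifferentiableAt ℝ X z) {j : Fin 3}
    (hYMA : covD A A 0 (curv A 0 j.succ) z = ∑ i : Fin 3, covD A A i.succ (curv A i.succ j.succ) z)
    (hYMB : covD B B 0 (curv B 0 j.succ) z =
      ∑ i : Fin 3, covD B B i.succ (curv B i.succ j.succ) z) :
    covD A B 0 (homCurv A B X 0 j.succ) z
        - ∑ i : Fin 3, covD A B i.succ (homCurv A B X i.succ j.succ) z =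
      homCurv A B (covD A B 0 X) 0 j.succ z
        - ∑ i : Fin 3, homCurv A B (covD A B i.succ X) i.succ j.succ z := by
  simp only [covD_homCurv hA hB hX, hYMA, hYMB, Finset.sum_add_distrib, Finset.sum_sub_distrib,
    ← Finset.sum_mul, ← Finset.mul_sum]
  abel

theorem isMaxwellSystem_of_covD {a e : Fin 3 → Spacetime → R} {f : Fin 3 → Fin 3 → Spacetime → R}
    (hA : ∀ μ, Continuous (A μ)) (hB : ∀ μ, Continuous (B μ)) (hanti : ∀ i j, f j i = -f i j)
    (ha : ∀ i, covD A B 0 (a i) =O[𝓟 openDiamond] fieldValues a e f)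
    (he : ∀ j, (fun z => covD A B 0 (e j) z - ∑ i : Fin 3, covD A B i.succ (f i j) z)
      =O[𝓟 openDiamond] fieldValues a e f)
    (hf : ∀ i j, (fun z => covD A B 0 (f i j) z
      - (covD A B i.succ (e j) z - covD A B j.succ (e i) z)) =O[𝓟 openDiamond] fieldValues a e f) :
    IsMaxwellSystem a e f := by
  obtain ⟨ha₀, he₀, hf₀⟩ := isBigO_fieldValues_iff.1 (isBigO_refl (fieldValues a e f)
    (𝓟 openDiamond))
  have hzeroth : ∀ {Y : Spacetime → R} (μ : Fin 4), Y =O[𝓟 openDiamond] fieldValues a e f →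
      (fun z => A μ z * Y z - Y z * B μ z) =O[𝓟 openDiamond] fieldValues a e f := fun μ hY =>
    isBigO_mul_sub_mul (hA μ) (hB μ) hY
  refine ⟨hanti, fun i => ?_, fun j => ?_, fun i j => ?_⟩
  · refine ((ha i).sub (hzeroth 0 (ha₀ i))).congr_left fun z => ?_
    simp only [covD]
    abel
  · refine ((he j).sub ((hzeroth 0 (he₀ j)).sub
      (IsBigO.fun_sum (s := Finset.univ) fun i _ => hzeroth i.succ (hf₀ i j)))).congr_left
        fun z => ?_
    simp only [covD, Finset.sum_add_distrib]
    abel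
  · refine ((hf i j).sub ((hzeroth 0 (hf₀ i j)).sub ((hzeroth i.succ (he₀ j)).sub
      (hzeroth j.succ (he₀ i))))).congr_left fun z => ?_
    simp only [covD]
    abel

theorem isMaxwellSystem_intertwiner (hA : ∀ μ, ContDiff ℝ ∞ (A μ)) (hB : ∀ μ, ContDiff ℝ ∞ (B μ))
    (hX : ContDiff ℝ ∞ X)
    (hYMA : ∀ z ∈ openDiamond, ∀ j : Fin 3, covD A A 0 (curv A 0 j.succ) z =
      ∑ i : Fin 3, covD A A i.succ (curv A i.succ j.succ) z)
    (hYMB : ∀ z ∈ openDiamond, ∀ j : Fin 3, covD B B 0 (curv B 0 j.succ) z =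
      ∑ i : Fin 3, covD B B i.succ (curv B i.succ j.succ) z)
    (h₀ : ∀ z ∈ openDiamond, covD A B 0 X z = 0) :
    IsMaxwellSystem (fun i => covD A B i.succ X) (fun j => homCurv A B X 0 j.succ)
      (fun i j => homCurv A B X i.succ j.succ) := by
  obtain ⟨ha, he, -⟩ := isBigO_fieldValues_iff.1 (isBigO_refl (fieldValues
    (fun i => covD A B i.succ X) (fun j => homCurv A B X 0 j.succ)
    (fun i j => homCurv A B X i.succ j.succ)) (𝓟 openDiamond))
  have hhom : ∀ (i : Fin 3) (μ ν : Fin 4), homCurv A B (covD A B i.succ X) μ ν =O[𝓟 openDiamond]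
      fieldValues (fun i => covD A B i.succ X) (fun j => homCurv A B X 0 j.succ)
        (fun i j => homCurv A B X i.succ j.succ) := fun i μ ν =>
    isBigO_mul_sub_mul (contDiff_curv hA μ ν).continuous (contDiff_curv hB μ ν).continuous (ha i)
  have hX' := hX.differentiable (by simp)
  refine isMaxwellSystem_of_covD (fun μ => (hA μ).continuous) (fun μ => (hB μ).continuous)
    (fun i j => homCurv_swap A B X _ _) (fun i => ?_) (fun j => ?_) (fun i j => ?_)
  · exact (he i).congr' (eventually_principal.2 fun z hz =>
      (covD_zero_covD_eq_homCurv hA hB hX h₀ hz i.succ).symm) .rfl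
  · refine (IsBigO.fun_sum (s := Finset.univ) fun i _ => hhom i i.succ j.succ).neg_left.congr'
      (eventually_principal.2 fun z hz => ?_) .rfl
    beta_reduce
    rw [homCurv_yangMills hA hB (hX' z) (hYMA z hz j) (hYMB z hz j)]
    simp [homCurv, h₀ z hz]
  · refine ((hhom i j.succ 0).add (hhom j 0 i.succ)).congr'
      (eventually_principal.2 fun z hz => ?_) .rfl
    have hbianchi := homCurv_bianchi hA hB (hX' z) 0 i.succ j.succ
    rw [homCurv_swap A B X 0 j.succ, covD_neg] at hbianchi
    have hzero : homCurv A B (covD A B 0 X) i.succ j.succ z = 0 := by simp [homCurv, h₀ z hz]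
    rw [hzero, zero_add] at hbianchi
    beta_reduce
    rw [← hbianchi]
    abel

theorem covD_eq_zero_of_yangMills [FiniteDimensional ℝ R] (hA : ∀ μ, ContDiff ℝ ∞ (A μ))
    (hB : ∀ μ, ContDiff ℝ ∞ (B μ)) (hX : ContDiff ℝ ∞ X)
    (hYMA : ∀ z ∈ openDiamond, ∀ j : Fin 3, covD A A 0 (curv A 0 j.succ) z =
      ∑ i : Fin 3, covD A A i.succ (curv A i.succ j.succ) z)
    (hYMB : ∀ z ∈ openDiamond, ∀ j : Fin 3, covD B B 0 (curv B 0 j.succ) z =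
      ∑ i : Fin 3, covD B B i.succ (curv B i.succ j.succ) z)
    (h₀ : ∀ z ∈ openDiamond, covD A B 0 X z = 0) {δ : ℝ} (hδ : 0 < δ)
    (hlow : ∀ z ∈ openDiamond, z.1 + 1 - ‖z.2‖ < δ → ∀ μ, covD A B μ X z = 0)
    (hz : z ∈ openDiamond) (μ : Fin 4) : covD A B μ X z = 0 := by
  have hsmooth : ∀ {f : Spacetime → R}, ContDiff ℝ ∞ f → ContDiff ℝ 1 f := fun hf =>
    hf.of_le (by simp)
  have hfields := (isMaxwellSystem_intertwiner hA hB hX hYMA hYMB h₀).fieldValues_eq_zero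
    (fun i => hsmooth (contDiff_covD hA hB hX _)) (fun j => hsmooth (contDiff_homCurv hA hB hX _ _))
    (fun i j => hsmooth (contDiff_homCurv hA hB hX _ _)) hδ (fun y hy hyδ => ?_) hz
  · exact Fin.cases (h₀ z hz) (fun i => congrFun (congrArg Prod.fst hfields) i) μ
  · have hopen : IsOpen {y : Spacetime | y.1 + 1 - ‖y.2‖ < δ} :=
      isOpen_lt (by fun_prop) continuous_const
    have hcovD : ∀ ν, covD A B ν X =ᶠ[nhds y] 0 := fun ν => Filter.eventuallyEq_of_mem
      ((isOpen_openDiamond.inter hopen).mem_nhds ⟨hy, hyδ⟩) fun w hw => hlow w hw.1 hw.2 ν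
    have hcurv : ∀ μ ν, homCurv A B X μ ν y = 0 := fun μ ν => by
      rw [← covD_covD_sub_covD_covD (fun μ => (hA μ).differentiable (by simp) y)
        (fun μ => (hB μ).differentiable (by simp) y) (contDiff_infty.1 hX 2) μ ν,
        covD_eq_zero_of_eventuallyEq (hcovD ν), covD_eq_zero_of_eventuallyEq (hcovD μ), sub_zero]
    simp only [fieldValues, hlow y hy hyδ, hcurv]
    rfl

end Intertwiner

/-! ### Extension from the diamond and cutoff at its lower boundary -/

section Extension

open scoped Manifold

theorem SmoothOn.exists_contDiff {F : Type*} [NormedAddCommGroup F] [NormedSpace ℝ F]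
    {s : Set Spacetime} (hs : IsClosed s) {f : Spacetime → F} (hf : SmoothOn s f) :
    ∃ g : Spacetime → F, ContDiff ℝ ∞ g ∧ EqOn f g s := by
  obtain ⟨O, g, hO, hsO, hg, hfg⟩ := hf
  obtain ⟨χ, hχ₀, hχ₁, -⟩ := exists_contMDiffMap_zero_one_nhds_of_isClosed 𝓘(ℝ, Spacetime) (n := ⊤)
    hO.isClosed_compl hs (disjoint_compl_left_iff_subset.2 hsO)
  have hχ : ContDiff ℝ ∞ χ := χ.contMDiff.contDiff
  refine ⟨fun z => χ z • g z, contDiff_iff_contDiffAt.2 fun z => ?_, fun z hz => ?_⟩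
  · by_cases hz : z ∈ O
    · exact hχ.contDiffAt.smul (hg.contDiffAt (hO.mem_nhds hz))
    · have hzero : (fun z => χ z • g z) =ᶠ[nhds z] fun _ => 0 := by
        filter_upwards [Filter.Eventually.filter_mono (nhds_le_nhdsSet hz) hχ₀] with y hy
        rw [hy, zero_smul]
      exact contDiffAt_const.congr_of_eventuallyEq hzero
  · simp only [hχ₁.self_of_nhdsSet z hz, one_smul, hfg hz]

theorem exists_contDiff_cutoff {δ : ℝ} (hδ : 0 < δ) : ∃ χ : Spacetime → ℝ, ContDiff ℝ ∞ χ ∧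
    (∀ z, z.1 + 1 - ‖z.2‖ ≤ 0 → χ z = 0) ∧ ∀ z, δ ≤ z.1 + 1 - ‖z.2‖ → χ z = 1 := by
  have hcont : Continuous fun z : Spacetime => z.1 + 1 - ‖z.2‖ := by fun_prop
  obtain ⟨χ, hχ₀, hχ₁, -⟩ := exists_contMDiffMap_zero_one_of_isClosed 𝓘(ℝ, Spacetime) (n := ⊤)
    (isClosed_le hcont continuous_const : IsClosed {z : Spacetime | z.1 + 1 - ‖z.2‖ ≤ 0})
    (isClosed_le continuous_const hcont : IsClosed {z : Spacetime | δ ≤ z.1 + 1 - ‖z.2‖})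
    (disjoint_left.2 fun z hz hz' => (hδ.trans_le (le_trans hz' hz)).false)
  exact ⟨χ, χ.contMDiff.contDiff, fun z hz => hχ₀ hz, fun z hz => hχ₁ hz⟩

theorem exists_pos_of_lowerBoundary_subset {N : Set Spacetime} (hN : IsOpen N)
    (hlower : lowerBoundary ⊆ N) :
    ∃ δ : ℝ, 0 < δ ∧ ∀ z ∈ diamond, z.1 + 1 - ‖z.2‖ < δ → z ∈ N := by
  have hcont : Continuous fun z : Spacetime => z.1 + 1 - ‖z.2‖ := by fun_prop
  have hpos : ∀ z ∈ diamond \ N, 0 < z.1 + 1 - ‖z.2‖ := fun z hz =>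
    sub_pos.2 (hz.1.1.lt_of_ne fun h => hz.2 (hlower ⟨hz.1, h⟩))
  obtain ⟨δ, hδ, hle⟩ := (isCompact_diamond.diff hN).exists_forall_le' hcont.continuousOn hpos
  exact ⟨δ, hδ, fun z hz hzδ => by_contra fun hzN => hzδ.not_ge (hle z ⟨hz, hzN⟩)⟩

end Extension

/-! ### Transport in time -/

section Transport

theorem hasDerivAt_pd_zero {V : Type*} [NormedAddCommGroup V] [NormedSpace ℝ V]
    {f : Spacetime → V} {t : ℝ} {x : EuclideanSpace ℝ (Fin 3)} (hf : DifferentiableAt ℝ f (t, x)) :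
    HasDerivAt (fun r => f (r, x)) (pd 0 f (t, x)) t := by
  have hline : HasDerivAt (fun r : ℝ => ((r, x) : Spacetime)) (1, 0) t :=
    (hasDerivAt_id t).prodMk (hasDerivAt_const t x)
  exact hf.hasFDerivAt.comp_hasDerivAt t hline

theorem hasDerivAt_of_covD_zero_eq_zero {R : Type*} [NormedRing R] [NormedAlgebra ℝ R]
    {A B : Fin 4 → Spacetime → R} {X : Spacetime → R} {t : ℝ} {x : EuclideanSpace ℝ (Fin 3)}
    (hX : DifferentiableAt ℝ X (t, x)) (h : covD A B 0 X (t, x) = 0) :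
    HasDerivAt (fun r => X (r, x)) (X (t, x) * B 0 (t, x) - A 0 (t, x) * X (t, x)) t := by
  rw [covD, add_eq_zero_iff_eq_neg, neg_sub] at h
  exact h ▸ hasDerivAt_pd_zero hX

theorem eq_zero_of_covD_zero_eq_zero {R : Type*} [NormedRing R] [NormedAlgebra ℝ R] [ProperSpace R]
    {A B : Fin 4 → Spacetime → R} {X : Spacetime → R} (hA : Continuous (A 0))
    (hB : Continuous (B 0)) (hX : Differentiable ℝ X) {t₀ t : ℝ} {x : EuclideanSpace ℝ (Fin 3)}
    (ht : t₀ ≤ t) (h : ∀ s ∈ Icc t₀ t, covD A B 0 X (s, x) = 0) (h₀ : X (t₀, x) = 0) :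
    X (t, x) = 0 :=
  eq_zero_of_hasDerivAt_mul_sub_mul (W := fun s => X (s, x)) ht
    (a := fun s => A 0 (s, x)) (b := fun s => B 0 (s, x)) (by fun_prop) (by fun_prop)
    (fun s hs => hasDerivAt_of_covD_zero_eq_zero (hX _) (h s hs)) h₀

theorem mem_matrixSet_of_covD_zero_eq_zero {n : ℕ}
    {G : Subgroup (Matrix.GeneralLinearGroup (Fin n) ℂ)}
    (hG : IsClosed (G : Set (Matrix.GeneralLinearGroup (Fin n) ℂ)))
    {A B : Fin 4 → Spacetime → Mat n} {X : Spacetime → Mat n} (hA : Continuous (A 0))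
    (hB : Continuous (B 0)) (hAG : ∀ z ∈ diamond, A 0 z ∈ lieAlg G)
    (hBG : ∀ z ∈ diamond, B 0 z ∈ lieAlg G) (hX : Differentiable ℝ X)
    (hlower : ∀ z ∈ lowerBoundary, X z ∈ matrixSet G)
    (h : ∀ z ∈ diamond, covD A B 0 X z = 0) {z : Spacetime} (hz : z ∈ diamond) :
    X z ∈ matrixSet G := by
  have hle : ‖z.2‖ - 1 ≤ z.1 := by linarith [hz.1]
  have hsegment : ∀ s ∈ Icc (‖z.2‖ - 1) z.1, ((s, z.2) : Spacetime) ∈ diamond := fun s hs =>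
    ⟨by linarith [hs.1], hz.2.trans (by linarith [hs.2])⟩
  exact mem_matrixSet_of_hasDerivAt hG (W := fun s => X (s, z.2))
    (a := fun s => A 0 (s, z.2)) (b := fun s => B 0 (s, z.2)) hle (by fun_prop) (by fun_prop)
    (fun s hs => hAG _ (hsegment s hs)) (fun s hs => hBG _ (hsegment s hs))
    (fun s hs => hasDerivAt_of_covD_zero_eq_zero (hX _) (h _ (hsegment s hs)))
    (hlower _ ⟨hsegment _ (left_mem_Icc.2 hle), by simp⟩)

variable {R : Type} [NormedRing R] [NormedAlgebra ℝ R] [FiniteDimensional ℝ R]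
  {A B : Fin 4 → Spacetime → R}

theorem exists_contDiff_covD_zero_eq (hA : ContDiff ℝ ∞ (A 0)) (hB : ContDiff ℝ ∞ (B 0))
    {γ : Spacetime → R} (hγ : ContDiff ℝ ∞ γ) (t₀ : ℝ) :
    ∃ w : Spacetime → R, ContDiff ℝ ∞ w ∧ (∀ x, w (t₀, x) = 0) ∧ ∀ z, covD A B 0 w z = γ z := by
  have := FiniteDimensional.complete ℝ R
  obtain ⟨w, hw, hw₀, hderiv⟩ := exists_contDiff_affineODE_solution
    (L := fun z => (ContinuousLinearMap.mul ℝ R).flip (B 0 z) - ContinuousLinearMap.mul ℝ R (A 0 z))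
    (by fun_prop) hγ t₀
  refine ⟨w, hw, hw₀, fun z => ?_⟩
  have hpd := (hasDerivAt_pd_zero (hw.differentiable (by simp) z)).unique (hderiv z.1 z.2)
  rw [covD, hpd]
  simp only [sub_apply, ContinuousLinearMap.flip_apply,
    ContinuousLinearMap.mul_apply']
  abel

/- The covariant time derivative of `U₀`, multiplied by a cutoff that vanishes below the diamond, is
the source of a correction that has no time to build up near the lower boundary. -/
theorem exists_contDiff_covD_zero_eq_zero (hA : ∀ μ, ContDiff ℝ ∞ (A μ))
    (hB : ∀ μ, ContDiff ℝ ∞ (B μ)) {U₀ : Spacetime → R} (hU₀ : ContDiff ℝ ∞ U₀) {δ : ℝ}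
    (hδ : 0 < δ) (hlow : ∀ z ∈ diamond, z.1 + 1 - ‖z.2‖ < δ → covD A B 0 U₀ z = 0) :
    ∃ U : Spacetime → R, ContDiff ℝ ∞ U ∧
      (∀ z ∈ diamond, z.1 + 1 - ‖z.2‖ < δ → U z = U₀ z) ∧ ∀ z ∈ diamond, covD A B 0 U z = 0 := by
  have := FiniteDimensional.proper_real R
  obtain ⟨χ, hχ, hχ₀, hχ₁⟩ := exists_contDiff_cutoff hδ
  obtain ⟨w, hw, hw₀, hcovD⟩ := exists_contDiff_covD_zero_eq (hA 0) (hB 0)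
    (γ := fun z => χ z • covD A B 0 U₀ z) (hχ.smul (contDiff_covD hA hB hU₀ 0)) (-1)
  have hcovD_diamond : ∀ z ∈ diamond, covD A B 0 w z = covD A B 0 U₀ z := fun z hz => by
    rcases lt_or_ge (z.1 + 1 - ‖z.2‖) δ with hzδ | hzδ
    · rw [hcovD, hlow z hz hzδ, smul_zero]
    · rw [hcovD, hχ₁ z hzδ, one_smul]
  have hw_low : ∀ z ∈ diamond, z.1 + 1 - ‖z.2‖ < δ → w z = 0 := fun z hz hzδ => by
    refine eq_zero_of_covD_zero_eq_zero (hA 0).continuous (hB 0).continuous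
      (hw.differentiable (by simp)) (by linarith [hz.1, norm_nonneg z.2]) (fun s hs => ?_) (hw₀ z.2)
    rcases le_total (s + 1 - ‖z.2‖) 0 with hs₀ | hs₀
    · rw [hcovD, hχ₀ (s, z.2) hs₀, zero_smul]
    · have hs_diamond : ((s, z.2) : Spacetime) ∈ diamond :=
        ⟨sub_nonneg.1 hs₀, hz.2.trans (by linarith [hs.2])⟩
      rw [hcovD_diamond _ hs_diamond, hlow _ hs_diamond (lt_of_le_of_lt (by linarith [hs.2]) hzδ)]
  refine ⟨fun z => U₀ z - w z, hU₀.sub hw, fun z hz hzδ => by simp [hw_low z hz hzδ],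
    fun z hz => ?_⟩
  rw [covD_sub (hU₀.differentiable (by simp) z) (hw.differentiable (by simp) z),
    hcovD_diamond z hz, sub_self]

end Transport

/-! ### Gauge equivalence -/

section GaugeEquivalence

variable {n : ℕ} {G : Subgroup (Matrix.GeneralLinearGroup (Fin n) ℂ)}
  {A B A' B' : Spacetime → Spacetime →L[ℝ] Mat n} {U : Spacetime → Mat n}

theorem sum_coords_smul_coordVec (v : Spacetime) : ∑ μ, coords v μ • coordVec μ = v := by
  rw [Fin.sum_univ_succ]
  simp only [coords, coordVec, Fin.cons_zero, Fin.cons_succ]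
  refine Prod.ext (by simp [Prod.fst_sum]) ?_
  ext i
  simp [Prod.snd_sum, Pi.single_apply]

theorem eq_of_forall_coordVec {V : Type*} [AddCommGroup V] [Module ℝ V] [TopologicalSpace V]
    {k l : Spacetime →L[ℝ] V} (h : ∀ μ, k (coordVec μ) = l (coordVec μ)) : k = l := by
  refine ContinuousLinearMap.ext fun v => ?_
  rw [← sum_coords_smul_coordVec v]
  simp only [map_sum, map_smul, h]

theorem gaugeRelatedAt_iff_covD {g : Spacetime → Matrix.GeneralLinearGroup (Fin n) ℂ}
    (hgU : EqOn (fun z => (g z : Mat n)) U diamond)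
    (hAA' : EqOn A A' diamond) (hBB' : EqOn B B' diamond) {z : Spacetime}
    (hU : DifferentiableAt ℝ U z) (hz : z ∈ diamond) :
    GaugeRelatedAt g A B z ↔ ∀ μ, covD (component A') (component B') μ U z = 0 := by
  have hfderiv : fderivWithin ℝ (fun y => (g y : Mat n)) diamond z = fderiv ℝ U z := by
    rw [fderivWithin_congr hgU (hgU hz), hU.fderivWithin (uniqueDiffOn_diamond z hz)]
  have hgz : (g z : Mat n) = U z := hgU hz
  let M := ContinuousLinearMap.mul ℝ (Mat n)
  let D : Spacetime →L[ℝ] Mat n := fderiv ℝ U z + (M.flip (U z) ∘L A' z - M (U z) ∘L B' z)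
  have hiff : ∀ v, (B z v =
      ((g z)⁻¹ : Matrix.GeneralLinearGroup (Fin n) ℂ) *
          fderivWithin ℝ (fun y => (g y : Mat n)) diamond z v
        + ((g z)⁻¹ : Matrix.GeneralLinearGroup (Fin n) ℂ) * A z v * (g z : Mat n)) ↔
      D v = 0 := fun v => by
    rw [hfderiv, hAA' hz, hBB' hz, mul_assoc, ← mul_add, eq_comm, Units.inv_mul_eq_iff_eq_mul, hgz,
      ← sub_eq_zero, add_sub_assoc]
    rfl
  refine ⟨fun h μ => (hiff _).1 (h (coordVec μ)), fun h v => (hiff v).2 ?_⟩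
  have hD : D = 0 := eq_of_forall_coordVec h
  rw [hD, zero_apply]

theorem basePoint_mem_lowerBoundary : basePoint ∈ lowerBoundary := by
  simp [lowerBoundary, diamond, basePoint]

theorem gaugeEquiv_of_covD_eq_zero (hU : ContDiff ℝ ∞ U) (hUG : ∀ z ∈ diamond, U z ∈ matrixSet G)
    (hUp : U basePoint = 1) (hAA' : EqOn A A' diamond) (hBB' : EqOn B B' diamond)
    (hcovD : ∀ z ∈ diamond, ∀ μ, covD (component A') (component B') μ U z = 0) :
    GaugeEquiv G A B := by
  have hlift : ∀ z, ∃ g : Matrix.GeneralLinearGroup (Fin n) ℂ,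
      z ∈ diamond → g ∈ G ∧ (g : Mat n) = U z := fun z => by
    by_cases hz : z ∈ diamond
    · obtain ⟨g, hg, hgz⟩ := hUG z hz
      exact ⟨g, fun _ => ⟨hg, hgz⟩⟩
    · exact ⟨1, fun h => absurd h hz⟩
  choose g hg using hlift
  have hgU : EqOn (fun z => (g z : Mat n)) U diamond := fun z hz => (hg z hz).2
  have hp := basePoint_mem_lowerBoundary.1
  exact ⟨g, ⟨⟨univ, U, isOpen_univ, subset_univ _, hU.contDiffOn, hgU⟩, fun z hz => (hg z hz).1,
    Units.ext ((hgU hp).trans hUp)⟩, fun z hz =>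
    (gaugeRelatedAt_iff_covD hgU hAA' hBB' (hU.differentiable (by simp) z) hz).2 (hcovD z hz)⟩

theorem GaugeEquivNearLower.exists_covD_eq_zero (hAB : GaugeEquivNearLower G A B)
    (hAA' : EqOn A A' diamond) (hBB' : EqOn B B' diamond) :
    ∃ U : Spacetime → Mat n, ContDiff ℝ ∞ U ∧ (∀ z ∈ diamond, U z ∈ matrixSet G) ∧
      U basePoint = 1 ∧ ∃ δ : ℝ, 0 < δ ∧ ∀ z ∈ diamond, z.1 + 1 - ‖z.2‖ < δ →
        ∀ μ, covD (component A') (component B') μ U z = 0 := by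
  obtain ⟨g, ⟨hg, hgG, hgp⟩, N, hN, hlower, hrel⟩ := hAB
  obtain ⟨U, hU, hgU⟩ := hg.exists_contDiff isClosed_diamond
  obtain ⟨δ, hδ, hδN⟩ := exists_pos_of_lowerBoundary_subset hN hlower
  have hp := basePoint_mem_lowerBoundary.1
  exact ⟨U, hU, fun z hz => ⟨g z, hgG z hz, hgU hz⟩, by simp [← hgU hp, hgp], δ, hδ,
    fun z hz hzδ => (gaugeRelatedAt_iff_covD hgU hAA' hBB' (hU.differentiable (by simp) z) hz).1
      (hrel z ⟨hδN z hz hzδ, hz⟩)⟩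

theorem exists_temporal_intertwiner (hG : IsClosed (G : Set (Matrix.GeneralLinearGroup (Fin n) ℂ)))
    (hAB : GaugeEquivNearLower G A B) (hA' : ContDiff ℝ ∞ A') (hB' : ContDiff ℝ ∞ B')
    (hAA' : EqOn A A' diamond) (hBB' : EqOn B B' diamond)
    (hAG : ∀ z ∈ diamond, ∀ v, A z v ∈ lieAlg G) (hBG : ∀ z ∈ diamond, ∀ v, B z v ∈ lieAlg G) :
    ∃ U : Spacetime → Mat n, ContDiff ℝ ∞ U ∧ (∀ z ∈ diamond, U z ∈ matrixSet G) ∧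
      U basePoint = 1 ∧ (∀ z ∈ diamond, covD (component A') (component B') 0 U z = 0) ∧
      ∃ δ : ℝ, 0 < δ ∧ ∀ z ∈ openDiamond, z.1 + 1 - ‖z.2‖ < δ →
        ∀ μ, covD (component A') (component B') μ U z = 0 := by
  have hcA := contDiff_component hA'
  have hcB := contDiff_component hB'
  obtain ⟨U₀, hU₀, hU₀G, hU₀p, δ, hδ, hlow₀⟩ := hAB.exists_covD_eq_zero hAA' hBB'
  obtain ⟨U, hU, hUU₀, hcovD⟩ := exists_contDiff_covD_zero_eq_zero hcA hcB hU₀ hδ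
    fun z hz hzδ => hlow₀ z hz hzδ 0
  have hUlower : ∀ z ∈ lowerBoundary, U z = U₀ z := fun z hz => hUU₀ z hz.1 (by simpa [hz.2])
  refine ⟨U, hU, fun z hz => ?_, ?_, hcovD, δ, hδ, fun z hz hzδ μ => ?_⟩
  · exact mem_matrixSet_of_covD_zero_eq_zero hG (hcA 0).continuous (hcB 0).continuous
      (fun z hz => by simpa only [component, ← hAA' hz] using hAG z hz _)
      (fun z hz => by simpa only [component, ← hBB' hz] using hBG z hz _)
      (hU.differentiable (by simp)) (fun z hz => hUlower z hz ▸ hU₀G z hz.1) hcovD hz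
  · rw [hUlower _ basePoint_mem_lowerBoundary, hU₀p]
  · have hopen : IsOpen {z : Spacetime | z.1 + 1 - ‖z.2‖ < δ} :=
      isOpen_lt (by fun_prop) continuous_const
    have heq : U =ᶠ[nhds z] U₀ := Filter.eventuallyEq_of_mem
      ((isOpen_openDiamond.inter hopen).mem_nhds ⟨hz, hzδ⟩)
      fun y hy => hUU₀ y (openDiamond_subset_diamond hy.1) hy.2
    rw [← hlow₀ z (openDiamond_subset_diamond hz) hzδ μ]
    simp only [covD, pd, heq.fderiv_eq, heq.eq_of_nhds]

end GaugeEquivalence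

end YangMills

open YangMills in
theorem mainTheorem6_general (n : ℕ) (G : Subgroup (Matrix.GeneralLinearGroup (Fin n) ℂ))
    (hclosed : IsClosed (G : Set (Matrix.GeneralLinearGroup (Fin n) ℂ)))
    (A B : Spacetime → Spacetime →L[ℝ] Mat n)
    (hA : IsConnection G A) (hB : IsConnection G B)
    (hYMA : SolvesYangMills A) (hYMB : SolvesYangMills B)
    (hAB : GaugeEquivNearLower G A B) :
    GaugeEquiv G A B := by
  obtain ⟨A', hA', hAA'⟩ := hA.1.exists_contDiff isClosed_diamond
  obtain ⟨B', hB', hBB'⟩ := hB.1.exists_contDiff isClosed_diamond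
  have hcA := contDiff_component hA'
  have hcB := contDiff_component hB'
  obtain ⟨U, hU, hUG, hUp, hcovD₀, δ, hδ, hlow⟩ :=
    exists_temporal_intertwiner hclosed hAB hA' hB' hAA' hBB' hA.2 hB.2
  have hopen : ∀ z ∈ openDiamond, ∀ μ, covD (component A') (component B') μ U z = 0 := fun z =>
    covD_eq_zero_of_yangMills hcA hcB hU
      (fun z hz => hYMA.covD_curv_zero_eq_sum hA' hAA' (openDiamond_subset_diamond hz))
      (fun z hz => hYMB.covD_curv_zero_eq_sum hB' hBB' (openDiamond_subset_diamond hz))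
      (fun z hz => hcovD₀ z (openDiamond_subset_diamond hz)) hδ hlow
  refine gaugeEquiv_of_covD_eq_zero hU hUG hUp hAA' hBB' fun z hz μ => ?_
  exact (isClosed_eq (contDiff_covD hcA hcB hU μ).continuous continuous_const).closure_subset_iff.2
    (fun y hy => hopen y hy μ) (diamond_subset_closure_openDiamond hz)

open YangMills in
theorem mainTheorem6 (n : ℕ) (G : Subgroup (Matrix.GeneralLinearGroup (Fin n) ℂ))
    (hcompact : IsCompact (G : Set (Matrix.GeneralLinearGroup (Fin n) ℂ)))
    (hconn : IsConnected (G : Set (Matrix.GeneralLinearGroup (Fin n) ℂ)))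
    (A B : Spacetime → Spacetime →L[ℝ] Mat n)
    (hA : IsConnection G A) (hB : IsConnection G B)
    (hYMA : SolvesYangMills A) (hYMB : SolvesYangMills B)
    (hAB : GaugeEquivNearLower G A B) :
    GaugeEquiv G A B := by
  exact mainTheorem6_general n G hcompact.isClosed A B hA hB hYMA hYMB hAB
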